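/- **Theorem (SIGM, large deviations).** *Problem.* Let $E$ be a finite-dimensional real normed space with norm $\|\cdot\|$, let $E^*$ be its dual with the dual norm $\|\cdot\|_*$, and write $\langle g,x\rangle$ for the value of $g\in E^*$ at $x\in E$. Let $Q\subset E$ be closed and convex, with $\|x-y\|\le D$ for all $x,y\in Q$, where $D>0$. Let $f,h$ be real functions, convex on $Q$, put $\varphi=f+h$, let $x^*\in Q$ be a minimizer of $\varphi$ on $Q$, and $\varphi^*=\varphi(x^*)$. *Oracle.* Let $L\ge 0$, $\delta\in\mathbb R$, $\sigma>0$. Suppose that for every $x\in Q$ there are $f_{\delta,L}(x)\in\mathbb R$, $g_{\delta,L}(x)\in E^*$ with $$0\le f(y)-f_{\delta,L}(x)-\langle g_{\delta,L}(x),y-x\rangle\le \tfrac L2\|x-y\|^2+\delta\qquad\text{for all } y\in Q$$ (so that $\delta\ge 0$). Let $\xi_0,\xi_1,\dots$ be i.i.d. random variables, distributed as $\xi$, and let $F_{\delta,L}(x,\xi)\in\mathbb R$ and $G_{\delta,L}(x,\xi)\in E^*$ be stochastic approximations ($G_{\delta,L}$ jointly measurable) such that, for every $x\in Q$, $$\mathbb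 E_\xi F_{\delta,L}(x,\xi)=f_{\delta,L}(x),\qquad \mathbb E_\xi G_{\delta,L}(x,\xi)=g_{\delta,L}(x),\qquad \mathbb E_\xi\|G_{\delta,L}(x,\xi)-g_{\delta,L}(x)\|_*^2\le\sigma^2,$$ $$\mathbb E_\xi\exp\!\left(\frac{\|G_{\delta,L}(x,\xi)-g_{\delta,L}(x)\|_*^2}{\sigma^2}\right)\le \exp(1).$$ *Prox-function.* Let $d$ be differentiable on $Q$ and strongly convex on $Q$ with parameter $1$ with respect to $\|\cdot\|$, normalized so that $\min_Q d=0$, and let $V(x,z)=d(x)-d(z)-\langle\nabla d(z),x-z\rangle$. Let $R>0$ satisfy $\sqrt{2d(x^*)}\le R$. *Coefficients.* Let $p\in[1,2]$, $a=2^{\frac{2p-1}{2}}$, $b=2^{\frac{5-2p}{4}}p^{\frac{1-2p}{2}}$ and, for $i\ge 0$, $$\alpha_i=\frac1a\Big(\frac{i+p}{p}\Big)^{p-1},\quad \beta_i=L+\frac{b\sigma}{R}(i+p+1)^{\frac{2p-1}{2}},\quad B_i=a\alpha_i^2,\quad A_i=\sum_{j=0}^i\alpha_j,\quad \tau_i=\frac{\alpha_{i+1}}{B_{i+1}}.$$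 *Method (SIGM).* Let $G_i:=G_{\delta,L}(x_i,\xi_i)$, $x_0=\arg\min_{x\in Q}d(x)$, $y_0=\arg\min_{x\in Q}\{\beta_0d(x)+\alpha_0\langle G_0,x-x_0\rangle+\alpha_0h(x)\}$ and, for $k\ge0$, $$z_k=\arg\min_{x\in Q}\Big\{\beta_kd(x)+\sum_{i=0}^k\alpha_i\langle G_i,x-x_i\rangle+A_kh(x)\Big\},\qquad x_{k+1}=\tau_kz_k+(1-\tau_k)y_k,$$ $$\hat x_{k+1}=\arg\min_{x\in Q}\big\{\beta_kV(x,z_k)+\alpha_{k+1}\langle G_{k+1},x-z_k\rangle+\alpha_{k+1}h(x)\big\},$$ $$w_{k+1}=\tau_k\hat x_{k+1}+(1-\tau_k)y_k,\qquad y_{k+1}=\frac{A_{k+1}-B_{k+1}}{A_{k+1}}y_k+\frac{B_{k+1}}{A_{k+1}}w_{k+1},$$ where it is supposed that all these minimizers exist. *Claim.* For every $k\ge1$ and every $\Omega\ge0$, $$\begin{aligned} &\mathbb P\Big(\varphi(y_k)-\varphi^*>\frac{C_1LR^2}{k^p}+\frac{C_2(1+\Omega)\sigma R}{\sqrt k}+C_3k^{p-1}\delta+\frac{C_4D\sigma\sqrt\Omega}{\sqrt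 k}\Big)\\ &\le\mathbb P\Big(\varphi(y_k)-\varphi^*>\frac{LR^2p^p2^{\frac{2p-3}{2}}}{(k+p)^p}+\frac{(1+\Omega)\sigma R\,2^{\frac{3+2p}{4}}\sqrt p\,(k+p+2)^{p-\frac12}}{(k+p)^p}\\ &\qquad\qquad+2^{2p-1}\Big(\Big(\frac{k+p}{p}\Big)^{p-1}+1\Big)\delta+\frac{2D\sigma\sqrt{6\Omega p}}{\sqrt{k+p}}\Big)\ \le\ 3\exp(-\Omega), \end{aligned}$$ where $C_1=4\sqrt2$, $C_2=16\sqrt2$, $C_3=48$, $C_4=4\sqrt3$. -/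

import Mathlib

open MeasureTheory ProbabilityTheory

namespace SIGM

section Setting

variable {E : Type*} [NormedAddCommGroup E] [NormedSpace ℝ E]

/-- `u` is a minimizer of `F` on `Q`, i.e. `u = argmin_{x ∈ Q} F x`. -/
def IsArgMin (F : E → ℝ) (Q : Set E) (u : E) : Prop :=
  u ∈ Q ∧ IsMinOn F Q u

/-- The pair of functions `(fo, go)` is a `(δ, L)`-oracle for `f` on `Q`. The dual space carries the
operator norm, which is the norm dual to the one of `E`. -/
def IsInexactOracle (Q : Set E) (f : E → ℝ) (L δ : ℝ) (fo : E → ℝ)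
    (go : E → StrongDual ℝ E) : Prop :=
  ∀ x ∈ Q, ∀ y ∈ Q,
    0 ≤ f y - fo x - go x (y - x) ∧ f y - fo x - go x (y - x) ≤ L / 2 * ‖x - y‖ ^ 2 + δ

/-- `(F, G)` is a stochastic approximation, driven by a random variable with law `ν`, of the
`(δ, L)`-oracle `(fo, go)` of `f` on `Q`: it is unbiased and the variance of `G` is at most
`σ ^ 2`. -/
structure IsStochasticOracle [MeasurableSpace E] {Ξ : Type*} [MeasurableSpace Ξ] (ν : Measure Ξ)
    (Q : Set E) (f : E → ℝ) (L δ σ : ℝ) (fo : E → ℝ) (go : E → StrongDual ℝ E)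
    (F : E → Ξ → ℝ) (G : E → Ξ → StrongDual ℝ E) : Prop where
  inexact : IsInexactOracle Q f L δ fo go
  measurable_G : Measurable (fun q : Q × Ξ => G q.1 q.2)
  integrable_F : ∀ x ∈ Q, Integrable (F x) ν
  mean_F : ∀ x ∈ Q, ∫ s, F x s ∂ν = fo x
  integrable_G : ∀ x ∈ Q, Integrable (G x) ν
  mean_G : ∀ x ∈ Q, ∫ s, G x s ∂ν = go x
  variance_G : ∀ x ∈ Q, ∫⁻ s, ENNReal.ofReal (‖G x s - go x‖ ^ 2) ∂ν ≤ ENNReal.ofReal (σ ^ 2)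

/-- The light-tail condition `𝔼 exp (‖G(x, ξ) - g(x)‖² / σ²) ≤ exp 1` for all `x ∈ Q`. -/
def IsLightTailed {Ξ : Type*} [MeasurableSpace Ξ] (ν : Measure Ξ) (Q : Set E) (σ : ℝ)
    (go : E → StrongDual ℝ E) (G : E → Ξ → StrongDual ℝ E) : Prop :=
  ∀ x ∈ Q, ∫⁻ s, ENNReal.ofReal (Real.exp (‖G x s - go x‖ ^ 2 / σ ^ 2)) ∂ν
    ≤ ENNReal.ofReal (Real.exp 1)

/-- `d` is a prox-function on `Q` with gradient map `gradd`: it is differentiable on `Q`, strongly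
convex with parameter `1` on `Q` with respect to the norm of `E`, and its minimal value on `Q`
is `0`, attained at `x₀`. -/
structure IsProxFunction (Q : Set E) (d : E → ℝ) (gradd : E → StrongDual ℝ E) (x₀ : E) : Prop where
  hasGrad : ∀ x ∈ Q, HasFDerivWithinAt d (gradd x) Q x
  strongConvex : StrongConvexOn Q 1 d
  argmin : IsArgMin d Q x₀
  apply_center : d x₀ = 0

/-- The Bregman distance `V(x, z) = d(x) - d(z) - ⟨∇d(z), x - z⟩`. -/
def bregman (d : E → ℝ) (gradd : E → StrongDual ℝ E) (x z : E) : ℝ :=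
  d x - d z - gradd z (x - z)

/-- `A_k = ∑_{i = 0}^k α_i`. -/
noncomputable def partialSum (α : ℕ → ℝ) (k : ℕ) : ℝ :=
  ∑ i ∈ Finset.range (k + 1), α i

/-- `τ_k = α_{k+1} / B_{k+1}`. -/
noncomputable def tau (α B : ℕ → ℝ) (k : ℕ) : ℝ :=
  α (k + 1) / B (k + 1)

/-- The sequences `x, y, z, xhat, w` are produced by the Stochastic Intermediate Gradient Method
with coefficients `α, β, B`, when the answer of the oracle at its `i`-th call, in the point `x i`,
is `answer i (x i)` (the values `xhat 0` and `w 0` play no role). -/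
structure IsRun (Q : Set E) (d : E → ℝ) (gradd : E → StrongDual ℝ E) (h : E → ℝ)
    (α β B : ℕ → ℝ) (answer : ℕ → E → StrongDual ℝ E) (x y z xhat w : ℕ → E) : Prop where
  x_zero : IsArgMin d Q (x 0)
  y_zero : IsArgMin
    (fun v => β 0 * d v + α 0 * answer 0 (x 0) (v - x 0) + α 0 * h v) Q (y 0)
  z_argmin : ∀ k, IsArgMin
    (fun v => β k * d v + ∑ i ∈ Finset.range (k + 1), α i * answer i (x i) (v - x i)
      + partialSum α k * h v) Q (z k)
  x_succ : ∀ k, x (k + 1) = tau α B k • z k + (1 - tau α B k) • y k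
  xhat_succ : ∀ k, IsArgMin
    (fun v => β k * bregman d gradd v (z k)
      + α (k + 1) * answer (k + 1) (x (k + 1)) (v - z k) + α (k + 1) * h v) Q (xhat (k + 1))
  w_succ : ∀ k, w (k + 1) = tau α B k • xhat (k + 1) + (1 - tau α B k) • y k
  y_succ : ∀ k, y (k + 1) =
    ((partialSum α (k + 1) - B (k + 1)) / partialSum α (k + 1)) • y k
      + (B (k + 1) / partialSum α (k + 1)) • w (k + 1)

end Setting

section Coefficients

/-- `a = 2^{(2p-1)/2}`. -/
noncomputable def aCoef (p : ℝ) : ℝ := (2 : ℝ) ^ ((2 * p - 1) / 2)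

/-- `b = 2^{(5-2p)/4} p^{(1-2p)/2}`. -/
noncomputable def bCoef (p : ℝ) : ℝ := (2 : ℝ) ^ ((5 - 2 * p) / 4) * p ^ ((1 - 2 * p) / 2)

/-- `α_i = (1/a) ((i+p)/p)^{p-1}`. -/
noncomputable def alphaSeq (p : ℝ) (i : ℕ) : ℝ :=
  1 / aCoef p * (((i : ℝ) + p) / p) ^ (p - 1)

/-- `β_i = L + (bσ/R) (i+p+1)^{(2p-1)/2}`. -/
noncomputable def betaSeq (p L σ R : ℝ) (i : ℕ) : ℝ :=
  L + bCoef p * σ / R * ((i : ℝ) + p + 1) ^ ((2 * p - 1) / 2)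

/-- `B_i = a α_i² = (1/a) ((i+p)/p)^{2p-2}`. -/
noncomputable def bSeq (p : ℝ) (i : ℕ) : ℝ :=
  aCoef p * alphaSeq p i ^ 2

end Coefficients

end SIGM

/-! The argument splits into a pathwise inequality and two exponential tail bounds. For the
inequality, consider the random model `β_k d(v) + ∑ α_i (fo(x_i) + ⟨G_i, v - x_i⟩) + A_k h(v)`,
whose minimizer is `z_k`. Its minimal value dominates `A_k φ(y_k)` up to accumulated errors
(`IsRun.estimate`). In the inductive step, the Bregman term gained from the optimality of `z_k`
pays, through the minimality of `xhat` and the strong convexity of `d`, for the smoothness error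
and, by Young's inequality, for part of the oracle noise `N_i = G_i - go(x_i)`. Comparing the model
at `z_k` and at the solution gives (`IsRun.gap_le`) `A_k (φ(y_k) - φ*) ≤ β_k d(x*) + δ ∑ B_i + ∑
(B_i / (2ρ_i)) ‖N_i‖² + ∑ α_i ⟨N_i, x* - anchor_i⟩`. The anchor is `x_0` or `z_{i-1}`, hence
determined by the realizations before the `i`-th, so the last sum has martingale increments.

The quadratic sum is controlled by convexity of `exp` and Markov's inequality. For the linear sum,
the light tail and zero mean give the sub-Gaussian estimate `𝔼 exp ⟨N, u⟩ ≤ exp (‖u‖² σ²)`;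
integrating out one fresh realization at a time multiplies these estimates, and an optimized
exponential Markov bound follows. Each event costs `exp (-Ω)`, so a union bound suffices.

Predictability is not assumed: it follows because the argmins are Lipschitz in their linear part, so
the iterates are measurable functions of past realizations. Finally, `A_k ≥ ((k + p) / p) ^ p / a`
and telescoping power sums turn the inequality into the explicit rate. -/

namespace SIGM

/-! ### Optimality conditions and Bregman distances -/

section ConvexAnalysis

open Filter Topology

variable {E : Type*} [NormedAddCommGroup E] [NormedSpace ℝ E] {Q : Set E} {d ψ : E → ℝ}

theorem convexOn_clm_comp_sub (hQ : Convex ℝ Q) (g : StrongDual ℝ E) (c : E) (a : ℝ) :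
    ConvexOn ℝ Q (fun v => a * g (v - c)) := by
  refine ⟨hQ, fun u _ v _ s t _ _ hst => le_of_eq ?_⟩
  have : s • u + t • v - c = s • (u - c) + t • (v - c) := by
    rw [smul_sub, smul_sub]
    nth_rewrite 1 [← one_smul ℝ c]
    rw [← hst, add_smul]
    abel
  simp only [this, map_add, map_smul, smul_eq_mul]
  ring

/-- Directional derivatives inside a convex set as limits of difference quotients. -/
theorem tendsto_slope_of_hasFDerivWithinAt (hQ : Convex ℝ Q) {g : StrongDual ℝ E} {z v : E}
    (hg : HasFDerivWithinAt d g Q z) (hz : z ∈ Q) (hv : v ∈ Q) :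
    Tendsto (fun n : ℕ => ((n : ℝ) + 1) * (d (z + (1 / ((n : ℝ) + 1)) • (v - z)) - d z)) atTop
      (𝓝 (g (v - z))) := by
  have h0 : Tendsto (fun n : ℕ => 1 / ((n : ℝ) + 1)) atTop (𝓝 0) :=
    tendsto_one_div_add_atTop_nhds_zero_nat
  have := hg.lim (l := atTop) (c := fun n : ℕ => (n : ℝ) + 1)
    (d := fun n : ℕ => (1 / ((n : ℝ) + 1)) • (v - z)) (v := v - z)
    (by simpa using h0.smul_const (v - z))
    (Eventually.of_forall fun n => hQ.add_smul_sub_mem hz hv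
      ⟨by positivity, by rw [div_le_one (by positivity)]; linarith [n.cast_nonneg (α := ℝ)]⟩)
    (by
      refine tendsto_const_nhds.congr fun n => ?_
      have : (n : ℝ) + 1 ≠ 0 := by positivity
      rw [smul_smul, mul_one_div_cancel this, one_smul])
  simpa using this

/-- First order optimality: a minimizer `z` of `β d + ψ` with `ψ` convex satisfies a three-point
inequality. -/
theorem IsArgMin.add_bregman_le {β : ℝ} {gradd : E → StrongDual ℝ E} {z v : E}
    (hψ : ConvexOn ℝ Q ψ) (hz : IsArgMin (fun u => β * d u + ψ u) Q z)
    (hg : HasFDerivWithinAt d (gradd z) Q z) (hv : v ∈ Q) :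
    β * d z + ψ z + β * bregman d gradd v z ≤ β * d v + ψ v := by
  have hlim := ((tendsto_slope_of_hasFDerivWithinAt hψ.1 hg hz.1 hv).const_mul β).add_const
    (ψ v - ψ z)
  have key := ge_of_tendsto' hlim (b := 0) fun n => by
    have hn : 0 < (n : ℝ) + 1 := by positivity
    have ht : 1 / ((n : ℝ) + 1) ≤ 1 := by
      rw [div_le_one hn]; linarith [n.cast_nonneg (α := ℝ)]
    set t : ℝ := 1 / ((n : ℝ) + 1) with htdef
    have ht0 : 0 ≤ t := by positivity
    have hnt : ((n : ℝ) + 1) * t = 1 := mul_one_div_cancel hn.ne'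
    have hmem := hψ.1.add_smul_sub_mem hz.1 hv ⟨ht0, ht⟩
    have hmin := isMinOn_iff.1 hz.2 _ hmem
    have hconv := hψ.2 hz.1 hv (sub_nonneg.2 ht) ht0 (by ring)
    have heq : (1 - t) • z + t • v = z + t • (v - z) := by
      rw [sub_smul, one_smul, smul_sub]; abel
    rw [heq, smul_eq_mul, smul_eq_mul] at hconv
    have h1 : 0 ≤ β * (d (z + t • (v - z)) - d z) + t * (ψ v - ψ z) := by linarith
    have h2 := mul_nonneg hn.le h1
    have h3 : ((n : ℝ) + 1) * (β * (d (z + t • (v - z)) - d z) + t * (ψ v - ψ z))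
        = β * (((n : ℝ) + 1) * (d (z + t • (v - z)) - d z)) + (((n : ℝ) + 1) * t) * (ψ v - ψ z) := by
      ring
    rw [h3, hnt, one_mul] at h2
    exact h2
  unfold bregman
  linarith

/-- Strong convexity on the segment from `z` to `v`, divided by the step `t = 1 / (n + 1)`, tends to
this inequality as `t → 0`. Only directions into `Q` are used, so a derivative within `Q` is enough.
-/
theorem half_sq_norm_le_bregman {gradd : E → StrongDual ℝ E} {z v : E}
    (hd : StrongConvexOn Q 1 d) (hg : HasFDerivWithinAt d (gradd z) Q z) (hz : z ∈ Q)
    (hv : v ∈ Q) : ‖v - z‖ ^ 2 / 2 ≤ bregman d gradd v z := by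
  have hlim := tendsto_slope_of_hasFDerivWithinAt hd.1 hg hz hv
  have hlim2 : Tendsto (fun n : ℕ => d v - d z - (1 - 1 / ((n : ℝ) + 1)) * (‖v - z‖ ^ 2 / 2)) atTop
      (𝓝 (d v - d z - (1 - 0) * (‖v - z‖ ^ 2 / 2))) :=
    ((tendsto_one_div_add_atTop_nhds_zero_nat.const_sub 1).mul_const _).const_sub _
  have key := le_of_tendsto_of_tendsto' hlim hlim2 fun n => by
    have hn : 0 < (n : ℝ) + 1 := by positivity
    have ht : 1 / ((n : ℝ) + 1) ≤ 1 := by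
      rw [div_le_one hn]; linarith [n.cast_nonneg (α := ℝ)]
    set t : ℝ := 1 / ((n : ℝ) + 1) with htdef
    have ht0 : 0 ≤ t := by positivity
    have hnt : ((n : ℝ) + 1) * t = 1 := mul_one_div_cancel hn.ne'
    have hconv := hd.2 hz hv (sub_nonneg.2 ht) ht0 (by ring)
    have heq : (1 - t) • z + t • v = z + t • (v - z) := by
      rw [sub_smul, one_smul, smul_sub]; abel
    rw [heq, smul_eq_mul, smul_eq_mul, norm_sub_rev z v] at hconv
    have h1 : d (z + t • (v - z)) - d z ≤ t * (d v - d z - (1 - t) * (‖v - z‖ ^ 2 / 2)) := by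
      linarith
    calc ((n : ℝ) + 1) * (d (z + t • (v - z)) - d z)
        ≤ ((n : ℝ) + 1) * (t * (d v - d z - (1 - t) * (‖v - z‖ ^ 2 / 2))) :=
          mul_le_mul_of_nonneg_left h1 hn.le
      _ = _ := by rw [← mul_assoc, hnt, one_mul]
  unfold bregman
  linarith

/-- A minimizer of `β d + ψ`, `ψ` convex, has quadratic growth. -/
theorem IsArgMin.add_sq_norm_le {β : ℝ} (hβ : 0 ≤ β) {gradd : E → StrongDual ℝ E} {z v : E}
    (hψ : ConvexOn ℝ Q ψ) (hd : StrongConvexOn Q 1 d)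
    (hz : IsArgMin (fun u => β * d u + ψ u) Q z)
    (hg : HasFDerivWithinAt d (gradd z) Q z) (hv : v ∈ Q) :
    β * d z + ψ z + β * (‖v - z‖ ^ 2 / 2) ≤ β * d v + ψ v :=
  (add_le_add_right (mul_le_mul_of_nonneg_left (half_sq_norm_le_bregman hd hg hz.1 hv) hβ) _).trans
    (hz.add_bregman_le hψ hg hv)

/-- Quadratic growth with zero additional function. It holds at any minimizer, so it serves both the
base step of the estimate sequence and the uniqueness of the prox-center. -/
theorem IsProxFunction.half_sq_norm_le {gradd : E → StrongDual ℝ E} {x₀ x v : E}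
    (hd : IsProxFunction Q d gradd x₀) (hx : IsArgMin d Q x) (hv : v ∈ Q) :
    ‖v - x‖ ^ 2 / 2 ≤ d v := by
  have h1 : IsArgMin (fun u => 1 * d u + (fun _ => (0 : ℝ)) u) Q x := by simpa using hx
  have h2 := h1.add_sq_norm_le zero_le_one (convexOn_const 0 hd.strongConvex.1)
    hd.strongConvex (hd.hasGrad x hx.1) hv
  have h3 : 0 ≤ d x := hd.apply_center ▸ isMinOn_iff.1 hd.argmin.2 x hx.1
  linarith

end ConvexAnalysis

/-! ### Pathwise estimate-sequence inequality -/

section EstimateSequence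

variable {E : Type*} [NormedAddCommGroup E] [NormedSpace ℝ E] {Q : Set E}

/-- One step of the estimate-sequence argument. -/
theorem estimate_step {f h : E → ℝ} (hf : ConvexOn ℝ Q f) (hh : ConvexOn ℝ Q h)
    {A α B β L δ ρ c : ℝ} (hα : 0 < α) (hαB : α ≤ B) (hBA : B ≤ A + α) (hρ : 0 < ρ)
    (hβ : α ^ 2 * (L + ρ) ≤ β * B) {γ g : StrongDual ℝ E} {x y z xh w y' : E}
    (hy : y ∈ Q) (hxh : xh ∈ Q) (hw : w ∈ Q)
    (hx_eq : x = (α / B) • z + (1 - α / B) • y) (hw_eq : w = (α / B) • xh + (1 - α / B) • y)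
    (hy_eq : y' = ((A + α - B) / (A + α)) • y + (B / (A + α)) • w)
    (hlow : c + g (y - x) ≤ f y) (hup : f w ≤ c + g (w - x) + L / 2 * ‖w - x‖ ^ 2 + δ) :
    (A + α) * (f y' + h y') ≤ A * (f y + h y) + β * (‖xh - z‖ ^ 2 / 2)
      + α * (c + γ (xh - x) + h xh) + B * δ + B / (2 * ρ) * ‖γ - g‖ ^ 2
      + (γ - g) (α • (x - z)) := by
  have hB : 0 < B := hα.trans_le hαB
  have hA : 0 < A + α := hB.trans_le hBA
  have hτ0 : 0 ≤ α / B := by positivity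
  have hτ1 : 0 ≤ 1 - α / B := sub_nonneg.2 ((div_le_one hB).2 hαB)
  have hcomb {F : E → ℝ} (hF : ConvexOn ℝ Q F) : (A + α) * F y' ≤ (A + α - B) * F y + B * F w := by
    have := hF.2 hy hw (div_nonneg (sub_nonneg.2 hBA) hA.le) (by positivity : 0 ≤ B / (A + α))
      (by field_simp; ring)
    rw [← hy_eq, smul_eq_mul, smul_eq_mul] at this
    calc (A + α) * F y' ≤ (A + α) * ((A + α - B) / (A + α) * F y + B / (A + α) * F w) :=
          mul_le_mul_of_nonneg_left this hA.le
      _ = _ := by field_simp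
  have h1 := hcomb hf
  have h2 := hcomb hh
  have h3 : B * h w ≤ α * h xh + (B - α) * h y := by
    have := hh.2 hxh hy hτ0 hτ1 (by ring)
    rw [← hw_eq, smul_eq_mul, smul_eq_mul] at this
    calc B * h w ≤ B * (α / B * h xh + (1 - α / B) * h y) := mul_le_mul_of_nonneg_left this hB.le
      _ = _ := by field_simp
  have h4 := mul_le_mul_of_nonneg_left hlow (sub_nonneg.2 hαB)
  have h5 := mul_le_mul_of_nonneg_left hup hB.le
  -- The same `y` enters `x` and `w` with the same weight, so their difference is a scaled copy of
  -- `xh - z`; this lets the prox term control the smoothness error.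
  have hwx : w - x = (α / B) • (xh - z) := by rw [hw_eq, hx_eq, smul_sub]; abel
  -- The lower oracle bound at `y` is used with weight `B - α`; this identity turns its linear part
  -- into one anchored at `z`.
  have hyx : (B - α) • (y - x) = α • (x - z) := by
    have e : y - x = (α / B) • (y - z) := by rw [hx_eq]; module
    have e' : x - z = (1 - α / B) • (y - z) := by rw [hx_eq]; module
    rw [e, e', smul_smul, smul_smul]
    congr 1
    field_simp
  have hg1 : (B - α) * g (y - x) = α * g (x - z) := by
    rw [← smul_eq_mul, ← map_smul, hyx, map_smul, smul_eq_mul]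
  have hg2 : B * g (w - x) = α * g (xh - z) := by
    rw [hwx, map_smul, smul_eq_mul]; field_simp
  set s := ‖w - x‖ with hs
  set N := ‖γ - g‖ with hN
  have hsr : s = α / B * ‖xh - z‖ := by
    rw [hs, hwx, norm_smul, Real.norm_of_nonneg hτ0]
  have hn : -(B * (N * s)) ≤ (γ - g) (α • (xh - z)) := by
    have := (γ - g).le_opNorm (w - x)
    rw [Real.norm_eq_abs] at this
    have h' : (γ - g) (α • (xh - z)) = B * (γ - g) (w - x) := by
      rw [hwx, map_smul, map_smul, smul_eq_mul, smul_eq_mul]; field_simp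
    rw [h', neg_le_iff_add_nonneg, ← mul_add]
    exact mul_nonneg hB.le (by linarith [(abs_le.1 this).1])
  have hβs : B * ((L + ρ) / 2 * s ^ 2) ≤ β * (‖xh - z‖ ^ 2 / 2) := by
    have : B * ((L + ρ) / 2 * s ^ 2) = (α ^ 2 * (L + ρ)) / B * (‖xh - z‖ ^ 2 / 2) := by
      rw [hsr]; field_simp
    rw [this]
    refine mul_le_mul_of_nonneg_right ?_ (by positivity)
    rwa [div_le_iff₀ hB]
  -- Young's inequality: `ρ` is the curvature reserved for absorbing the noise acting on `w - x`.
  have hsq : 0 ≤ B * (ρ / 2 * s ^ 2 - N * s + N ^ 2 / (2 * ρ)) := by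
    have : ρ / 2 * s ^ 2 - N * s + N ^ 2 / (2 * ρ) = (ρ * s - N) ^ 2 / (2 * ρ) := by
      field_simp; ring
    rw [this]; positivity
  have hB2 : B / (2 * ρ) * N ^ 2 = B * (N ^ 2 / (2 * ρ)) := by ring
  have e1 : (γ - g) (α • (x - z)) = α * γ (x - z) - α * g (x - z) := by
    simp only [sub_apply, map_smul, smul_eq_mul, mul_sub]
  have e2 : (γ - g) (α • (xh - z)) = α * γ (xh - z) - α * g (xh - z) := by
    simp only [sub_apply, map_smul, smul_eq_mul, mul_sub]
  have e3 : γ (xh - x) = γ (xh - z) - γ (x - z) := by rw [← map_sub]; congr 1; abel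
  rw [hB2, e1, e3]
  rw [e2] at hn
  linarith

/-- The point in whose direction from the solution the `i`-th oracle noise acts: `x 0` if `i = 0`,
and `z (i - 1)` otherwise. -/
def anchor (x z : ℕ → E) : ℕ → E
  | 0 => x 0
  | i + 1 => z i

/-- The sign, monotonicity and balance conditions on the coefficients of the method under which
the estimate-sequence argument works. -/
structure IsAdmissible (α β B ρ : ℕ → ℝ) (L : ℝ) : Prop where
  pos : ∀ i, 0 < α i
  le_B : ∀ i, α i ≤ B i
  B_zero : B 0 = α 0
  B_le : ∀ i, B i ≤ partialSum α i
  beta_nonneg : ∀ i, 0 ≤ β i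
  beta_mono : ∀ i, β i ≤ β (i + 1)
  rho_pos : ∀ i, 0 < ρ i
  balance_zero : α 0 * (L + ρ 0) ≤ β 0
  balance : ∀ i, α (i + 1) ^ 2 * (L + ρ (i + 1)) ≤ β i * B (i + 1)

variable {d h : E → ℝ} {gradd : E → StrongDual ℝ E} {α β B : ℕ → ℝ}
  {answer : ℕ → E → StrongDual ℝ E} {x y z xhat w : ℕ → E}

theorem partialSum_succ (α : ℕ → ℝ) (k : ℕ) :
    partialSum α (k + 1) = partialSum α k + α (k + 1) := Finset.sum_range_succ _ _

theorem IsAdmissible.tau_mem {ρ : ℕ → ℝ} {L : ℝ} (hc : IsAdmissible α β B ρ L) (k : ℕ) :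
    0 ≤ tau α B k ∧ 0 ≤ 1 - tau α B k := by
  have hB := (hc.pos (k + 1)).trans_le (hc.le_B (k + 1))
  exact ⟨div_nonneg (hc.pos _).le hB.le, sub_nonneg.2 ((div_le_one hB).2 (hc.le_B _))⟩

theorem IsRun.w_mem (hQ : Convex ℝ Q) {ρ : ℕ → ℝ} {L : ℝ} (hc : IsAdmissible α β B ρ L)
    (hr : IsRun Q d gradd h α β B answer x y z xhat w) {k : ℕ} (hy : y k ∈ Q) :
    w (k + 1) ∈ Q := by
  rw [hr.w_succ]
  exact hQ (hr.xhat_succ k).1 hy (hc.tau_mem k).1 (hc.tau_mem k).2 (by ring)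

theorem IsRun.y_mem (hQ : Convex ℝ Q) {ρ : ℕ → ℝ} {L : ℝ} (hc : IsAdmissible α β B ρ L)
    (hr : IsRun Q d gradd h α β B answer x y z xhat w) (k : ℕ) : y k ∈ Q := by
  induction k with
  | zero => exact hr.y_zero.1
  | succ k ih =>
    have hB := (hc.pos (k + 1)).trans_le (hc.le_B (k + 1))
    have hA := hB.trans_le (hc.B_le (k + 1))
    rw [hr.y_succ]
    exact hQ ih (hr.w_mem hQ hc ih) (div_nonneg (sub_nonneg.2 (hc.B_le _)) hA.le)
      (div_nonneg hB.le hA.le) (by field_simp; ring)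

theorem IsRun.x_mem (hQ : Convex ℝ Q) {ρ : ℕ → ℝ} {L : ℝ} (hc : IsAdmissible α β B ρ L)
    (hr : IsRun Q d gradd h α β B answer x y z xhat w) (k : ℕ) : x k ∈ Q := by
  cases k with
  | zero => exact hr.x_zero.1
  | succ k =>
    rw [hr.x_succ]
    exact hQ (hr.z_argmin k).1 (hr.y_mem hQ hc k) (hc.tau_mem k).1 (hc.tau_mem k).2 (by ring)

theorem IsRun.anchor_mem (hr : IsRun Q d gradd h α β B answer x y z xhat w) (k : ℕ) :
    anchor x z k ∈ Q := by
  cases k with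
  | zero => exact hr.x_zero.1
  | succ k => exact (hr.z_argmin k).1

variable {f fo : E → ℝ} {go : E → StrongDual ℝ E} {x₀ : E} {L δ : ℝ} {ρ : ℕ → ℝ}

/-- The estimate sequence controls the objective at `y k`. -/
theorem IsRun.estimate (hf : ConvexOn ℝ Q f) (hh : ConvexOn ℝ Q h)
    (hd : IsProxFunction Q d gradd x₀) (ho : IsInexactOracle Q f L δ fo go)
    (hc : IsAdmissible α β B ρ L) (hr : IsRun Q d gradd h α β B answer x y z xhat w) (k : ℕ) :
    partialSum α k * (f (y k) + h (y k)) ≤ β k * d (z k)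
      + ∑ i ∈ Finset.range (k + 1), α i * (fo (x i) + answer i (x i) (z k - x i))
      + partialSum α k * h (z k)
      + ∑ i ∈ Finset.range (k + 1), (B i * δ + B i / (2 * ρ i) * ‖answer i (x i) - go (x i)‖ ^ 2
        + (answer i (x i) - go (x i)) (α i • (x i - anchor x z i))) := by
  have hQ := hf.1
  have hA0 : partialSum α 0 = α 0 := by simp [partialSum]
  induction k with
  | zero =>
    have hmin := isMinOn_iff.1 hr.y_zero.2 _ (hr.z_argmin 0).1
    have hmin' := isMinOn_iff.1 (hr.z_argmin 0).2 _ hr.y_zero.1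
    simp only [zero_add, Finset.range_one, Finset.sum_singleton, hA0, anchor] at hmin hmin' ⊢
    have hx := hr.x_zero.1
    have hy := hr.y_zero.1
    have hα := hc.pos 0
    have hB := hc.B_zero
    have hlow := (ho _ hx _ hx).1
    have hup := (ho _ hx _ hy).2
    rw [norm_sub_rev] at hup
    have hbal : α 0 ^ 2 * (L + ρ 0) ≤ β 0 * B 0 := by
      rw [hB, sq]
      calc α 0 * α 0 * (L + ρ 0) = α 0 * (L + ρ 0) * α 0 := by ring
        _ ≤ β 0 * α 0 := mul_le_mul_of_nonneg_right hc.balance_zero hα.le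
    -- The initial step is the degenerate case `A = 0`, `B = α`, in which the old points are all `x
    -- 0` and the new ones all `y 0`.
    have hstep := estimate_step (A := 0) (α := α 0) (B := B 0) (β := β 0) (L := L) (δ := δ)
      (ρ := ρ 0) (c := fo (x 0)) (γ := answer 0 (x 0)) (g := go (x 0)) (x := x 0) (y := x 0)
      (z := x 0) (xh := y 0) (w := y 0) (y' := y 0) hf hh hα hB.ge (by rw [hB, zero_add])
      (hc.rho_pos 0) hbal hx hy hy
      (by rw [hB, div_self hα.ne']; simp) (by rw [hB, div_self hα.ne']; simp)
      (by rw [hB, zero_add, div_self hα.ne']; simp) (by linarith) (by linarith)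
    have hprox := mul_le_mul_of_nonneg_left (hd.half_sq_norm_le hr.x_zero hy) (hc.beta_nonneg 0)
    rw [zero_add] at hstep
    linarith
  | succ k ih =>
    have hxQ := hr.x_mem hQ hc (k + 1)
    have hyQ := hr.y_mem hQ hc k
    have hwQ := hr.w_mem hQ hc hyQ
    have hlow := (ho _ hxQ _ hyQ).1
    have hup := (ho _ hxQ _ hwQ).2
    rw [norm_sub_rev] at hup
    have hBA := hc.B_le (k + 1)
    have hy_eq := hr.y_succ k
    rw [partialSum_succ] at hBA hy_eq
    have hstep := estimate_step (β := β k) (δ := δ) (γ := answer (k + 1) (x (k + 1)))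
      (g := go (x (k + 1))) (c := fo (x (k + 1)))
      hf hh (hc.pos (k + 1)) (hc.le_B (k + 1)) hBA (hc.rho_pos (k + 1))
      (hc.balance k) hyQ (hr.xhat_succ k).1 hwQ (hr.x_succ k) (hr.w_succ k)
      hy_eq (by linarith) (by linarith)
    have hβ := hc.beta_nonneg k
    have hzk := hr.z_argmin k
    have hzQ := hzk.1
    have hvQ := (hr.z_argmin (k + 1)).1
    have hψ : ConvexOn ℝ Q (fun v => ∑ i ∈ Finset.range (k + 1), α i * answer i (x i) (v - x i)
        + partialSum α k * h v) := by
      refine ConvexOn.add ?_ (hh.smul (Finset.sum_nonneg fun i _ => (hc.pos i).le))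
      have : ∀ s : Finset ℕ, ConvexOn ℝ Q (fun v => ∑ i ∈ s, α i * answer i (x i) (v - x i)) := by
        intro s
        induction s using Finset.induction_on with
        | empty => simpa using convexOn_const (0 : ℝ) hQ
        | insert i s hi ih =>
          simp only [Finset.sum_insert hi]
          exact (convexOn_clm_comp_sub hQ _ _ _).add ih
      exact this _
    have hz' : IsArgMin (fun v => β k * d v + (∑ i ∈ Finset.range (k + 1),
        α i * answer i (x i) (v - x i) + partialSum α k * h v)) Q (z k) := by
      simpa only [add_assoc] using hzk
    -- Moving the model from `z k` to `z (k + 1)` gains `β k * V(z (k + 1), z k)`; together with the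
    -- new linear and composite terms this is the objective minimized by `xhat (k + 1)`.
    have hopt := hz'.add_bregman_le hψ (hd.hasGrad _ hzQ) hvQ
    have hxhat := isMinOn_iff.1 (hr.xhat_succ k).2 _ hvQ
    have hbreg := mul_le_mul_of_nonneg_left
      (half_sq_norm_le_bregman hd.strongConvex (hd.hasGrad _ hzQ) hzQ (hr.xhat_succ k).1) hβ
    have hdv : 0 ≤ d (z (k + 1)) := hd.apply_center ▸ isMinOn_iff.1 hd.argmin.2 _ hvQ
    -- Replacing `β k` by `β (k + 1)` only raises the model, because `d` is nonnegative on `Q`.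
    have hmono := mul_le_mul_of_nonneg_right (hc.beta_mono k) hdv
    simp only [mul_add, Finset.sum_add_distrib] at ih ⊢
    simp only [Finset.sum_range_succ _ (k + 1), partialSum_succ, anchor, mul_add, map_sub]
      at ih hstep hxhat hopt ⊢
    simp only [mul_sub, add_mul] at ih hstep hxhat hopt ⊢
    linarith

/-- The deterministic bound behind the convergence of the method. -/
theorem IsRun.gap_le (hf : ConvexOn ℝ Q f) (hh : ConvexOn ℝ Q h)
    (hd : IsProxFunction Q d gradd x₀) (ho : IsInexactOracle Q f L δ fo go)
    (hc : IsAdmissible α β B ρ L) (hr : IsRun Q d gradd h α β B answer x y z xhat w)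
    {u : E} (hu : u ∈ Q) (k : ℕ) :
    partialSum α k * ((f (y k) + h (y k)) - (f u + h u)) ≤ β k * d u
      + (∑ i ∈ Finset.range (k + 1), B i) * δ
      + ∑ i ∈ Finset.range (k + 1), B i / (2 * ρ i) * ‖answer i (x i) - go (x i)‖ ^ 2
      + ∑ i ∈ Finset.range (k + 1),
          (answer i (x i) - go (x i)) (α i • (u - anchor x z i)) := by
  have hest := hr.estimate hf hh hd ho hc k
  have hmin := isMinOn_iff.1 (hr.z_argmin k).2 _ hu
  have hsum : ∑ i ∈ Finset.range (k + 1), α i * (fo (x i) + answer i (x i) (u - x i))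
      ≤ ∑ i ∈ Finset.range (k + 1), (α i * f u + (answer i (x i) - go (x i)) (α i • (u - x i))) := by
    refine Finset.sum_le_sum fun i _ => ?_
    have := mul_le_mul_of_nonneg_left
      (sub_nonneg.1 (ho _ (hr.x_mem hf.1 hc i) _ hu).1) (hc.pos i).le
    simp only [sub_apply, map_smul, smul_eq_mul]
    linarith
  -- The query point `x i` cancels between the two noise sums, leaving the direction from the anchor
  -- to `u`.
  have hnoise : ∑ i ∈ Finset.range (k + 1), (answer i (x i) - go (x i)) (α i • (u - x i))
      + ∑ i ∈ Finset.range (k + 1), (answer i (x i) - go (x i)) (α i • (x i - anchor x z i))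
      = ∑ i ∈ Finset.range (k + 1), (answer i (x i) - go (x i)) (α i • (u - anchor x z i)) := by
    rw [← Finset.sum_add_distrib]
    refine Finset.sum_congr rfl fun i _ => ?_
    rw [← map_add, ← smul_add, sub_add_sub_cancel]
  simp only [mul_add, Finset.sum_add_distrib, ← Finset.sum_mul] at hest hsum ⊢
  change _ ≤ partialSum α k * f u + _ at hsum
  linarith

end EstimateSequence

/-! ### Exponential moments and tail bounds for the oracle noise -/

section Probability

/-- For `|x| ≤ 1` compare `exp x` with `1 + x + x²`; outside that range the quadratic dominates. The
linear term vanishes in expectation for a centred variable. -/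
theorem exp_le_add_exp_sq (x : ℝ) : Real.exp x ≤ x + Real.exp (x ^ 2) := by
  have h2 := Real.add_one_le_exp (x ^ 2)
  rcases le_total |x| 1 with h | h
  · have := (abs_le.1 (Real.abs_exp_sub_one_sub_id_le h)).2
    linarith
  · rcases le_total 0 x with hx | hx
    · rw [abs_of_nonneg hx] at h
      have := Real.exp_le_exp.2 (show x ≤ x ^ 2 by nlinarith)
      linarith
    · rw [abs_of_nonpos hx] at h
      have := Real.exp_le_one_iff.2 hx
      nlinarith

/-- A pointwise bound giving sub-Gaussian moment generating functions: `Y` is a centred variable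
with `Y ^ 2 ≤ q W`, where `exp W` has expectation at most `exp 1`. -/
theorem exists_exp_le_affine {q : ℝ} (hq : 0 ≤ q) :
    ∃ κ θ : ℝ, 0 ≤ θ ∧ ∀ Y W : ℝ, Y ^ 2 ≤ q * W →
      Real.exp Y ≤ κ * Y + Real.exp q * (θ * Real.exp (W - 1) + (1 - θ)) := by
  have hconv : ∀ θ W : ℝ, 0 ≤ θ → θ ≤ 1 →
      Real.exp (θ * (W - 1)) ≤ θ * Real.exp (W - 1) + (1 - θ) := fun θ W h0 h1 => by
    have := convexOn_exp.2 (Set.mem_univ (W - 1)) (Set.mem_univ 0) h0 (sub_nonneg.2 h1) (by ring)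
    simpa using this
  rcases le_total q 1 with h | h
  · refine ⟨1, q, hq, fun Y W hYW => (exp_le_add_exp_sq Y).trans ?_⟩
    have h1 : Real.exp (Y ^ 2) ≤ Real.exp q * Real.exp (q * (W - 1)) := by
      rw [← Real.exp_add]
      exact Real.exp_le_exp.2 (by linarith)
    have h2 := mul_le_mul_of_nonneg_left (hconv q W hq h) (Real.exp_pos q).le
    linarith
  -- For large `q`, centring is unnecessary: `Y ≤ (q + W) / 2 ≤ q + (W - 1) / 2`, the last step
  -- using `q ≥ 1`.
  · refine ⟨0, 1 / 2, by norm_num, fun Y W hYW => ?_⟩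
    have h1 : Real.exp Y ≤ Real.exp q * Real.exp (1 / 2 * (W - 1)) := by
      rw [← Real.exp_add]
      refine Real.exp_le_exp.2 ?_
      have hW : 0 ≤ W := by
        by_contra! hW
        nlinarith [sq_nonneg Y]
      have : Y ≤ q / 2 + W / 2 := by
        refine le_of_abs_le (abs_le_of_sq_le_sq ?_ (by positivity))
        nlinarith [sq_nonneg (q - W)]
      linarith
    have h2 := mul_le_mul_of_nonneg_left (hconv (1 / 2) W (by norm_num) (by norm_num))
      (Real.exp_pos q).le
    linarith

variable {E : Type*} [NormedAddCommGroup E] [NormedSpace ℝ E]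
  {Ξ : Type*} [MeasurableSpace Ξ] {ν : Measure Ξ}

/-- Sub-Gaussian bound for a centred, light-tailed random functional evaluated at a fixed vector. -/
theorem lintegral_exp_apply_le [IsProbabilityMeasure ν] {N : Ξ → StrongDual ℝ E} {σ : ℝ}
    (hσ : 0 < σ) (hN : Measurable N) (hint : Integrable N ν) (hmean : ∫ s, N s ∂ν = 0)
    (htail : ∫⁻ s, ENNReal.ofReal (Real.exp (‖N s‖ ^ 2 / σ ^ 2)) ∂ν ≤ ENNReal.ofReal (Real.exp 1))
    {u : E} {q : ℝ} (hq : ‖u‖ ^ 2 * σ ^ 2 ≤ q) :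
    ∫⁻ s, ENNReal.ofReal (Real.exp (N s u)) ∂ν ≤ ENNReal.ofReal (Real.exp q) := by
  obtain ⟨κ, θ, hθ, hle⟩ := exists_exp_le_affine (q := q) (le_trans (by positivity) hq)
  have hWm : Measurable fun s => Real.exp (‖N s‖ ^ 2 / σ ^ 2) :=
    Real.measurable_exp.comp ((hN.norm.pow_const 2).div_const _)
  have hWint : Integrable (fun s => Real.exp (‖N s‖ ^ 2 / σ ^ 2)) ν := by
    refine ⟨hWm.aestronglyMeasurable, ?_⟩
    rw [hasFiniteIntegral_iff_ofReal (Filter.Eventually.of_forall fun s => (Real.exp_pos _).le)]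
    exact htail.trans_lt ENNReal.ofReal_lt_top
  have hWle : ∫ s, Real.exp (‖N s‖ ^ 2 / σ ^ 2) ∂ν ≤ Real.exp 1 := by
    rw [← ofReal_integral_eq_lintegral_ofReal hWint
      (Filter.Eventually.of_forall fun s => (Real.exp_pos _).le)] at htail
    exact (ENNReal.ofReal_le_ofReal_iff (Real.exp_pos _).le).1 htail
  have hYint : Integrable (fun s => N s u) ν := hint.apply_continuousLinearMap u
  have hYmean : ∫ s, N s u ∂ν = 0 := by
    rw [← ContinuousLinearMap.integral_apply hint, hmean]; simp
  have hWint' : Integrable (fun s => Real.exp (‖N s‖ ^ 2 / σ ^ 2 - 1)) ν := by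
    simp only [Real.exp_sub]
    exact hWint.div_const _
  have hbint : Integrable (fun s => κ * N s u + Real.exp q *
      (θ * Real.exp (‖N s‖ ^ 2 / σ ^ 2 - 1) + (1 - θ))) ν :=
    (hYint.const_mul κ).add (((hWint'.const_mul θ).add (integrable_const _)).const_mul _)
  have hpt : ∀ s, Real.exp (N s u) ≤ κ * N s u + Real.exp q *
      (θ * Real.exp (‖N s‖ ^ 2 / σ ^ 2 - 1) + (1 - θ)) := fun s => by
    refine hle _ _ ?_
    have h1 : (N s u) ^ 2 ≤ (‖N s‖ * ‖u‖) ^ 2 := by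
      rw [← sq_abs]
      exact pow_le_pow_left₀ (abs_nonneg _) ((N s).le_opNorm u) 2
    calc (N s u) ^ 2 ≤ (‖N s‖ * ‖u‖) ^ 2 := h1
      _ = ‖u‖ ^ 2 * σ ^ 2 * (‖N s‖ ^ 2 / σ ^ 2) := by field_simp
      _ ≤ q * (‖N s‖ ^ 2 / σ ^ 2) := mul_le_mul_of_nonneg_right hq (by positivity)
  refine (lintegral_mono fun s => ENNReal.ofReal_le_ofReal (hpt s)).trans ?_
  rw [← ofReal_integral_eq_lintegral_ofReal hbint
    (Filter.Eventually.of_forall fun s => (Real.exp_pos _).le.trans (hpt s))]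
  refine ENNReal.ofReal_le_ofReal ?_
  have hW1 : ∫ s, Real.exp (‖N s‖ ^ 2 / σ ^ 2 - 1) ∂ν ≤ 1 := by
    simp only [Real.exp_sub]
    rw [integral_div, div_le_one (Real.exp_pos _)]
    exact hWle
  have hI1 : Integrable (fun s => κ * N s u) ν := hYint.const_mul κ
  have hI2 : Integrable (fun s => θ * Real.exp (‖N s‖ ^ 2 / σ ^ 2 - 1)) ν := hWint'.const_mul θ
  have hI3 : Integrable (fun s => Real.exp q *
      (θ * Real.exp (‖N s‖ ^ 2 / σ ^ 2 - 1) + (1 - θ))) ν :=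
    (hI2.add (integrable_const _)).const_mul _
  rw [integral_add hI1 hI3, integral_const_mul, integral_const_mul, hYmean,
    integral_add hI2 (integrable_const _), integral_const_mul, integral_const]
  simp only [probReal_univ, one_smul, mul_zero, zero_add]
  have : θ * ∫ s, Real.exp (‖N s‖ ^ 2 / σ ^ 2 - 1) ∂ν + (1 - θ) ≤ 1 := by nlinarith
  nlinarith [Real.exp_pos q]

/-- Markov's inequality in exponential form. -/
theorem measure_lt_le_exp_neg {S : Type*} [MeasurableSpace S] {P : Measure S} {Z : S → ℝ}
    (hZ : Measurable Z) {c : ℝ}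
    (hc : ∫⁻ s, ENNReal.ofReal (Real.exp (Z s)) ∂P ≤ ENNReal.ofReal (Real.exp c)) (Ω : ℝ) :
    P {s | c + Ω < Z s} ≤ ENNReal.ofReal (Real.exp (-Ω)) := by
  have hm : Measurable fun s => ENNReal.ofReal (Real.exp (Z s)) :=
    ENNReal.measurable_ofReal.comp (Real.measurable_exp.comp hZ)
  have h1 := (mul_meas_ge_le_lintegral (μ := P) hm (ENNReal.ofReal (Real.exp (c + Ω)))).trans hc
  have h2 : P {s | c + Ω < Z s}
      ≤ P {s | ENNReal.ofReal (Real.exp (c + Ω)) ≤ ENNReal.ofReal (Real.exp (Z s))} :=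
    measure_mono fun s hs => ENNReal.ofReal_le_ofReal (Real.exp_le_exp.2 (le_of_lt hs))
  refine h2.trans ?_
  have hpos : ENNReal.ofReal (Real.exp (c + Ω)) ≠ 0 := by
    simpa using Real.exp_pos (c + Ω)
  rw [mul_comm, ← ENNReal.le_div_iff_mul_le (Or.inl hpos) (Or.inl ENNReal.ofReal_ne_top),
    ← ENNReal.ofReal_div_of_pos (Real.exp_pos _), ← Real.exp_sub] at h1
  simpa using h1

theorem lintegral_prod_of_indepFun {S T : Type*} [MeasurableSpace S] [MeasurableSpace T]
    {P : Measure S} [IsProbabilityMeasure P] {H : S → T} (hH : Measurable H) {η : S → Ξ}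
    (hη : Measurable η) (hlaw : P.map η = ν) (hind : IndepFun H η P) {Φ : T × Ξ → ENNReal}
    (hΦ : Measurable Φ) :
    ∫⁻ s, Φ (H s, η s) ∂P = ∫⁻ s, ∫⁻ e, Φ (H s, e) ∂ν ∂P := by
  have : IsProbabilityMeasure ν := hlaw ▸ Measure.isProbabilityMeasure_map hη.aemeasurable
  rw [← lintegral_map (f := Φ) hΦ (hH.prodMk hη),
    (indepFun_iff_map_prod_eq_prod_map_map hH.aemeasurable hη.aemeasurable).1 hind, hlaw,
    lintegral_prod _ hΦ.aemeasurable, lintegral_map hΦ.lintegral_prod_right' hH]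

/-- Integrating out a variable which is independent of the history. -/
theorem lintegral_history_prod {S : Type*} {m : MeasurableSpace S} [mS : MeasurableSpace S]
    {P : Measure S} [IsProbabilityMeasure P] (hm : m ≤ mS) {η : S → Ξ} (hη : Measurable η)
    (hlaw : P.map η = ν) (hind : Indep m (MeasurableSpace.comap η inferInstance) P)
    {Φ : S × Ξ → ENNReal} (hΦ : Measurable[m.prod inferInstance] Φ) :
    ∫⁻ s, Φ (s, η s) ∂P = ∫⁻ s, ∫⁻ e, Φ (s, e) ∂ν ∂P := by
  -- The history is encoded as the identity map from `S` to `S` equipped with the smaller σ-algebra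
  -- `m`.
  refine @lintegral_prod_of_indepFun Ξ _ ν S S mS m P _ id (measurable_id'' hm) η hη hlaw ?_ Φ hΦ
  rw [IndepFun_iff_Indep (mβ := m) id η P, @MeasurableSpace.comap_id S m]
  exact hind

/-- The `σ`-algebra generated by the first `k` realizations. -/
abbrev history {S : Type*} (ξ : ℕ → S → Ξ) (k : ℕ) : MeasurableSpace S :=
  ⨆ i ∈ Set.Iio k, MeasurableSpace.comap (ξ i) inferInstance

section History

variable {S : Type*} {ξ : ℕ → S → Ξ}

theorem history_mono {i j : ℕ} (hij : i ≤ j) : history ξ i ≤ history ξ j :=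
  biSup_mono fun _ hl => lt_of_lt_of_le hl hij

theorem measurable_history {i j : ℕ} (hij : i < j) : Measurable[history ξ j] (ξ i) := by
  rw [measurable_iff_comap_le]
  exact le_iSup₂_of_le (f := fun i (_ : i ∈ Set.Iio j) =>
    MeasurableSpace.comap (ξ i) inferInstance) i hij le_rfl

theorem history_le [mS : MeasurableSpace S] (hξ : ∀ i, Measurable (ξ i)) (k : ℕ) :
    history ξ k ≤ mS :=
  iSup₂_le fun i _ => (hξ i).comap_le

theorem indep_history [MeasurableSpace S] {P : Measure S} (hξ : ∀ i, Measurable (ξ i))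
    (hind : iIndepFun ξ P) (k : ℕ) :
    Indep (history ξ k) (MeasurableSpace.comap (ξ k) inferInstance) P := by
  have := indep_iSup_of_disjoint (fun i => (hξ i).comap_le)
    ((iIndepFun_iff_iIndep _ ξ P).1 hind) (S := Set.Iio k) (T := {k}) (by simp)
  simpa [history] using this

end History

section Oracle

variable [FiniteDimensional ℝ E] [MeasurableSpace E] {Q : Set E} {f : E → ℝ} {L δ σ : ℝ} {fo : E → ℝ}
  {go : E → StrongDual ℝ E} {F : E → Ξ → ℝ} {G : E → Ξ → StrongDual ℝ E}

/-- Measurability of the mean oracle is inherited from `G` as a parametric integral, and only on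
`Q`, where joint measurability is given. -/
theorem IsStochasticOracle.measurable_go [IsProbabilityMeasure ν]
    (ho : IsStochasticOracle ν Q f L δ σ fo go F G) : Measurable fun x : Q => go x := by
  have h : StronglyMeasurable fun x : Q => ∫ s, G x s ∂ν :=
    StronglyMeasurable.integral_prod_right' (f := fun q : Q × Ξ => G q.1 q.2)
      ho.measurable_G.stronglyMeasurable
  have e : (fun x : Q => go x) = fun x : Q => ∫ s, G x s ∂ν :=
    funext fun x => (ho.mean_G x x.2).symm
  rw [e]
  exact h.measurable

theorem IsStochasticOracle.measurable_noise [IsProbabilityMeasure ν]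
    (ho : IsStochasticOracle ν Q f L δ σ fo go F G) :
    Measurable fun q : Q × Ξ => G q.1 q.2 - go q.1 :=
  ho.measurable_G.sub (ho.measurable_go.comp measurable_fst)

theorem IsStochasticOracle.measurable_noise_comp [IsProbabilityMeasure ν]
    (ho : IsStochasticOracle ν Q f L δ σ fo go F G) {T : Type*} [MeasurableSpace T]
    {X : T → E} (hX : Measurable X) (hXQ : ∀ t, X t ∈ Q) {η : T → Ξ} (hη : Measurable η) :
    Measurable fun t => G (X t) (η t) - go (X t) :=
  ho.measurable_noise.comp ((hX.subtype_mk (h := hXQ)).prodMk hη)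

variable {S : Type*} [mS : MeasurableSpace S] {P : Measure S} [IsProbabilityMeasure P]
  {ξ : ℕ → S → Ξ} {X : ℕ → S → E}

/-- Large deviations of the accumulated squared noise of the oracle. -/
theorem measure_sum_sq_noise_lt_le
    (ho : IsStochasticOracle ν Q f L δ σ fo go F G) (hlight : IsLightTailed ν Q σ go G)
    (hσ : 0 < σ) (hξ : ∀ i, Measurable (ξ i)) (hlaw : ∀ i, P.map (ξ i) = ν)
    (hind : iIndepFun ξ P) (hX : ∀ i, Measurable[history ξ i] (X i)) (hXQ : ∀ i s, X i s ∈ Q)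
    {c : ℕ → ℝ} (hc : ∀ i, 0 ≤ c i) (k : ℕ) (hpos : 0 < ∑ i ∈ Finset.range k, c i) (Ω : ℝ) :
    P {s | (1 + Ω) * σ ^ 2 * ∑ i ∈ Finset.range k, c i < ∑ i ∈ Finset.range k,
      c i * ‖G (X i s) (ξ i s) - go (X i s)‖ ^ 2} ≤ ENNReal.ofReal (Real.exp (-Ω)) := by
  have : IsProbabilityMeasure ν := hlaw 0 ▸ Measure.isProbabilityMeasure_map (hξ 0).aemeasurable
  set C := ∑ i ∈ Finset.range k, c i with hC
  set N : ℕ → S → ℝ := fun i s => ‖G (X i s) (ξ i s) - go (X i s)‖ ^ 2 / σ ^ 2 with hNdef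
  have hNm : ∀ i, Measurable (N i) := fun i =>
    ((ho.measurable_noise_comp ((hX i).mono (history_le hξ i) le_rfl) (hXQ i)
      (hξ i)).norm.pow_const 2).div_const _
  have hexp : ∀ i, ∫⁻ s, ENNReal.ofReal (Real.exp (N i s)) ∂P ≤ ENNReal.ofReal (Real.exp 1) := by
    intro i
    have hΦ : Measurable[(history ξ i).prod inferInstance] fun q : S × Ξ =>
        ENNReal.ofReal (Real.exp (‖G (X i q.1) q.2 - go (X i q.1)‖ ^ 2 / σ ^ 2)) := by
      have hXi := hX i
      let _ := history ξ i
      exact ENNReal.measurable_ofReal.comp (Real.measurable_exp.comp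
        (((ho.measurable_noise_comp (hXi.comp measurable_fst)
          (fun q : S × Ξ => hXQ i q.1) measurable_snd).norm.pow_const 2).div_const _))
    have hprod := lintegral_history_prod (history_le hξ i) (hξ i) (hlaw i)
      (indep_history hξ hind i) hΦ
    refine hprod.le.trans ((lintegral_mono fun s => hlight _ (hXQ i s)).trans ?_)
    simp
  -- Jensen with weights `c i / C` reduces the sum to its individual terms, so no independence
  -- between the terms is needed.
  have hconv : ∀ s, ENNReal.ofReal (Real.exp (∑ i ∈ Finset.range k, c i / C * N i s))
      ≤ ∑ i ∈ Finset.range k, ENNReal.ofReal (c i / C) * ENNReal.ofReal (Real.exp (N i s)) := by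
    intro s
    have := convexOn_exp.map_sum_le (t := Finset.range k) (w := fun i => c i / C)
      (p := fun i => N i s) (fun i _ => div_nonneg (hc i) hpos.le)
      (by rw [← Finset.sum_div, div_self hpos.ne']) (fun _ _ => Set.mem_univ _)
    simp only [smul_eq_mul] at this
    refine (ENNReal.ofReal_le_ofReal this).trans_eq ?_
    rw [ENNReal.ofReal_sum_of_nonneg fun i _ =>
      mul_nonneg (div_nonneg (hc i) hpos.le) (Real.exp_pos _).le]
    exact Finset.sum_congr rfl fun i _ => ENNReal.ofReal_mul (div_nonneg (hc i) hpos.le)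
  have htot : ∫⁻ s, ENNReal.ofReal (Real.exp (∑ i ∈ Finset.range k, c i / C * N i s)) ∂P
      ≤ ENNReal.ofReal (Real.exp 1) := by
    refine (lintegral_mono hconv).trans ?_
    have hm : ∀ i, Measurable fun s => ENNReal.ofReal (c i / C) * ENNReal.ofReal (Real.exp (N i s)) :=
      fun i => (ENNReal.measurable_ofReal.comp (Real.measurable_exp.comp (hNm i))).const_mul _
    rw [lintegral_finsetSum _ fun i _ => hm i]
    calc ∑ i ∈ Finset.range k, ∫⁻ s, ENNReal.ofReal (c i / C) *
          ENNReal.ofReal (Real.exp (N i s)) ∂P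
        ≤ ∑ i ∈ Finset.range k, ENNReal.ofReal (c i / C) * ENNReal.ofReal (Real.exp 1) := by
          refine Finset.sum_le_sum fun i _ => ?_
          rw [lintegral_const_mul' _ _ ENNReal.ofReal_ne_top]
          exact mul_le_mul_right (hexp i) _
      _ = ENNReal.ofReal (Real.exp 1) := by
          rw [← Finset.sum_mul, ← ENNReal.ofReal_sum_of_nonneg fun i _ =>
            div_nonneg (hc i) hpos.le, ← Finset.sum_div, div_self hpos.ne']
          simp
  have hZm : Measurable fun s => ∑ i ∈ Finset.range k, c i / C * N i s :=
    Finset.measurable_sum _ fun i _ => (hNm i).const_mul _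
  refine (measure_mono fun s hs => ?_).trans (measure_lt_le_exp_neg hZm htot Ω)
  have : ∑ i ∈ Finset.range k, c i / C * N i s = (∑ i ∈ Finset.range k,
      c i * ‖G (X i s) (ξ i s) - go (X i s)‖ ^ 2) / (σ ^ 2 * C) := by
    rw [Finset.sum_div]
    exact Finset.sum_congr rfl fun i _ => by simp only [hNdef]; field_simp
  rw [Set.mem_ofPred_eq, this, lt_div_iff₀ (by positivity), ← mul_assoc]
  exact hs

variable [BorelSpace E]

theorem measurable_clm_apply {T : Type*} [MeasurableSpace T] {g : T → StrongDual ℝ E}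
    (hg : Measurable g) {U : T → E} (hU : Measurable U) : Measurable fun t => g t (U t) :=
  (isBoundedBilinearMap_apply (𝕜 := ℝ) (E := E) (F := ℝ)).continuous.measurable.comp
    (hg.prodMk hU)

/-- Exponential supermartingale bound for the accumulated noise of the oracle. -/
theorem lintegral_exp_sum_noise_le
    (ho : IsStochasticOracle ν Q f L δ σ fo go F G) (hlight : IsLightTailed ν Q σ go G)
    (hσ : 0 < σ) (hξ : ∀ i, Measurable (ξ i)) (hlaw : ∀ i, P.map (ξ i) = ν)
    (hind : iIndepFun ξ P) (hX : ∀ i, Measurable[history ξ i] (X i)) (hXQ : ∀ i s, X i s ∈ Q)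
    {U : ℕ → S → E} (hU : ∀ i, Measurable[history ξ i] (U i)) {r : ℕ → ℝ}
    (hUr : ∀ i s, ‖U i s‖ ≤ r i) (k : ℕ) :
    Measurable[history ξ k] (fun s => ∑ i ∈ Finset.range k,
      (G (X i s) (ξ i s) - go (X i s)) (U i s)) ∧
    ∫⁻ s, ENNReal.ofReal (Real.exp (∑ i ∈ Finset.range k,
      (G (X i s) (ξ i s) - go (X i s)) (U i s))) ∂P
      ≤ ENNReal.ofReal (Real.exp (∑ i ∈ Finset.range k, r i ^ 2 * σ ^ 2)) := by
  have : IsProbabilityMeasure ν := hlaw 0 ▸ Measure.isProbabilityMeasure_map (hξ 0).aemeasurable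
  induction k with
  | zero => simp
  | succ k ih =>
    obtain ⟨ihm, ih⟩ := ih
    have hterm : Measurable[history ξ (k + 1)]
        fun s => (G (X k s) (ξ k s) - go (X k s)) (U k s) := by
      have hle : history ξ k ≤ history ξ (k + 1) := history_mono k.le_succ
      let _ := history ξ (k + 1)
      exact measurable_clm_apply (ho.measurable_noise_comp ((hX k).mono hle le_rfl) (hXQ k)
        (measurable_history k.lt_succ_self)) ((hU k).mono hle le_rfl)
    refine ⟨?_, ?_⟩
    · simp only [Finset.sum_range_succ]
      exact (ihm.mono (history_mono k.le_succ) le_rfl).add hterm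
    set Z : S → ℝ := fun s => ∑ i ∈ Finset.range k, (G (X i s) (ξ i s) - go (X i s)) (U i s)
    have hΦ : Measurable[(history ξ k).prod inferInstance] fun q : S × Ξ =>
        ENNReal.ofReal (Real.exp (Z q.1)) *
          ENNReal.ofReal (Real.exp ((G (X k q.1) q.2 - go (X k q.1)) (U k q.1))) := by
      have hXk := hX k
      have hUk := hU k
      let _ := history ξ k
      have h1 : Measurable fun q : S × Ξ => (G (X k q.1) q.2 - go (X k q.1)) (U k q.1) :=
        measurable_clm_apply (ho.measurable_noise_comp (hXk.comp measurable_fst)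
          (fun q => hXQ k q.1) measurable_snd) (hUk.comp measurable_fst)
      exact (ENNReal.measurable_ofReal.comp (Real.measurable_exp.comp
        (ihm.comp measurable_fst))).mul (ENNReal.measurable_ofReal.comp
          (Real.measurable_exp.comp h1))
    have hprod := lintegral_history_prod (history_le hξ k) (hξ k) (hlaw k)
      (indep_history hξ hind k) hΦ
    simp only [Finset.sum_range_succ, Real.exp_add, ENNReal.ofReal_mul (Real.exp_pos _).le]
    refine hprod.le.trans ?_
    -- With the history frozen, `X k s` and `U k s` are fixed, and the one-vector sub-Gaussian bound
    -- applies to the fresh realization.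
    have hstep : ∀ s, ∫⁻ e, ENNReal.ofReal (Real.exp (Z s)) *
        ENNReal.ofReal (Real.exp ((G (X k s) e - go (X k s)) (U k s))) ∂ν
        ≤ ENNReal.ofReal (Real.exp (Z s)) * ENNReal.ofReal (Real.exp (r k ^ 2 * σ ^ 2)) := by
      intro s
      have hN : Measurable fun e => G (X k s) e - go (X k s) :=
        ho.measurable_noise_comp (T := Ξ) measurable_const (fun _ => hXQ k s) measurable_id
      have hQ := hXQ k s
      rw [lintegral_const_mul' _ _ ENNReal.ofReal_ne_top]
      refine mul_le_mul_right (lintegral_exp_apply_le hσ hN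
        ((ho.integrable_G _ hQ).sub (integrable_const _)) ?_ (hlight _ hQ) ?_) _
      · rw [integral_sub (ho.integrable_G _ hQ) (integrable_const _), ho.mean_G _ hQ]
        simp
      · exact mul_le_mul_of_nonneg_right
          (pow_le_pow_left₀ (norm_nonneg _) (hUr k s) 2) (sq_nonneg σ)
    refine (lintegral_mono hstep).trans ?_
    rw [lintegral_mul_const' _ _ ENNReal.ofReal_ne_top]
    exact mul_le_mul_left ih _

/-- Large deviations of the accumulated noise of the oracle. -/
theorem measure_sum_noise_lt_le
    (ho : IsStochasticOracle ν Q f L δ σ fo go F G) (hlight : IsLightTailed ν Q σ go G)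
    (hσ : 0 < σ) (hξ : ∀ i, Measurable (ξ i)) (hlaw : ∀ i, P.map (ξ i) = ν)
    (hind : iIndepFun ξ P) (hX : ∀ i, Measurable[history ξ i] (X i)) (hXQ : ∀ i s, X i s ∈ Q)
    {U : ℕ → S → E} (hU : ∀ i, Measurable[history ξ i] (U i)) {r : ℕ → ℝ}
    (hUr : ∀ i s, ‖U i s‖ ≤ r i) (k : ℕ) {Ω : ℝ} (hΩ : 0 ≤ Ω)
    (hV : 0 < ∑ i ∈ Finset.range k, r i ^ 2) :
    P {s | 2 * σ * √(Ω * ∑ i ∈ Finset.range k, r i ^ 2) < ∑ i ∈ Finset.range k,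
      (G (X i s) (ξ i s) - go (X i s)) (U i s)} ≤ ENNReal.ofReal (Real.exp (-Ω)) := by
  rcases hΩ.eq_or_lt with rfl | hΩ
  · simpa using prob_le_one
  set V := ∑ i ∈ Finset.range k, r i ^ 2 with hVdef
  -- The optimal Chernoff parameter: the log-moment bound becomes `l² V σ² = Ω` and the scaled
  -- threshold `2Ω`, leaving `exp (-Ω)`.
  have hl : 0 < √(Ω / V) / σ := by positivity
  set l := √(Ω / V) / σ with hldef
  obtain ⟨hm, hle⟩ := lintegral_exp_sum_noise_le ho hlight hσ hξ hlaw hind hX hXQ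
    (U := fun i s => l • U i s) (fun i => (hU i).const_smul l) (r := fun i => l * r i)
    (fun i s => by
      rw [norm_smul, Real.norm_of_nonneg hl.le]
      exact mul_le_mul_of_nonneg_left (hUr i s) hl.le) k
  have hl2 : l ^ 2 * (V * σ ^ 2) = Ω := by
    rw [hldef, div_pow, Real.sq_sqrt (by positivity)]
    field_simp
  have hsum : ∑ i ∈ Finset.range k, (l * r i) ^ 2 * σ ^ 2 = Ω := by
    rw [← hl2, hVdef, Finset.sum_mul, Finset.mul_sum]
    exact Finset.sum_congr rfl fun i _ => by ring
  rw [hsum] at hle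
  have hMarkov := measure_lt_le_exp_neg (hm.mono (history_le hξ k) le_rfl) hle Ω
  refine (measure_mono fun s hs => ?_).trans hMarkov
  have hlin : ∑ i ∈ Finset.range k, (G (X i s) (ξ i s) - go (X i s)) (l • U i s)
      = l * ∑ i ∈ Finset.range k, (G (X i s) (ξ i s) - go (X i s)) (U i s) := by
    simp only [map_smul, smul_eq_mul, Finset.mul_sum]
  have hthr : l * (2 * σ * √(Ω * V)) = Ω + Ω := by
    have : √(Ω / V) * √(Ω * V) = Ω := by
      rw [← Real.sqrt_mul (by positivity), show Ω / V * (Ω * V) = Ω ^ 2 by field_simp,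
        Real.sqrt_sq hΩ.le]
    rw [hldef]
    calc √(Ω / V) / σ * (2 * σ * √(Ω * V)) = 2 * (√(Ω / V) * √(Ω * V)) := by field_simp
      _ = Ω + Ω := by rw [this]; ring
  rw [Set.mem_ofPred_eq, hlin, ← hthr]
  exact mul_lt_mul_of_pos_left hs hl

end Oracle

end Probability

/-! ### Measurable dependence of minimizers and prox-gradients -/

section Measurability

variable {E : Type*} [NormedAddCommGroup E] [NormedSpace ℝ E] {Q : Set E} {d h : E → ℝ}
  {gradd : E → StrongDual ℝ E} {x₀ : E}

theorem IsProxFunction.continuousOn (hd : IsProxFunction Q d gradd x₀) : ContinuousOn d Q :=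
  fun x hx => (hd.hasGrad x hx).continuousWithinAt

theorem IsArgMin.of_eq_add_const {X : Type*} {Q : Set X} {F F' : X → ℝ} {u : X} (c : ℝ) (hu : IsArgMin F Q u)
    (h : ∀ v ∈ Q, F v = F' v + c) : IsArgMin F' Q u :=
  ⟨hu.1, isMinOn_iff.2 fun v hv => by
    have := isMinOn_iff.1 hu.2 v hv
    rw [h v hv, h u hu.1] at this
    linarith⟩

theorem IsProxFunction.argmin_unique (hd : IsProxFunction Q d gradd x₀) {u : E}
    (hu : IsArgMin d Q u) : u = x₀ := by
  have h1 := hd.half_sq_norm_le hu hd.argmin.1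
  rw [hd.apply_center] at h1
  have : ‖x₀ - u‖ = 0 := by nlinarith [norm_nonneg (x₀ - u)]
  exact (sub_eq_zero.1 (norm_eq_zero.1 this)).symm

section

variable [MeasurableSpace E] [BorelSpace E]

/-- A pointwise limit of difference quotients, each measurable because `d` is continuous on `Q`. -/
theorem IsProxFunction.measurable_gradd_sub (hd : IsProxFunction Q d gradd x₀) {v : E}
    (hv : v ∈ Q) : Measurable fun z : Q => gradd z (v - z) := by
  have hQ := hd.strongConvex.1
  have hdm : Measurable fun z : Q => d z := hd.continuousOn.domRestrict.measurable
  refine measurable_of_tendsto_metrizable (f := fun (n : ℕ) (z : Q) =>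
    ((n : ℝ) + 1) * (d (z + (1 / ((n : ℝ) + 1)) • (v - z)) - d z)) (fun n => ?_)
    (tendsto_pi_nhds.2 fun z =>
      tendsto_slope_of_hasFDerivWithinAt hQ (hd.hasGrad z z.2) z.2 hv)
  have hmem : ∀ z : Q, (z : E) + (1 / ((n : ℝ) + 1)) • (v - z) ∈ Q := fun z =>
    hQ.add_smul_sub_mem z.2 hv
      ⟨by positivity, by rw [div_le_one (by positivity)]; linarith [n.cast_nonneg (α := ℝ)]⟩
  have hcont : Continuous fun z : Q => (z : E) + (1 / ((n : ℝ) + 1)) • (v - z) := by fun_prop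
  exact ((hdm.comp (hcont.measurable.subtype_mk (h := hmem))).sub hdm).const_mul _

/-- Minimizers of `β d + g + ψ` on `Q` depend measurably on the functional `g`. -/
theorem measurable_argmin {T : Type*} [MeasurableSpace T] {ψ : E → ℝ} {β : ℝ} (hβ : 0 < β)
    (hd : IsProxFunction Q d gradd x₀) (hψ : ConvexOn ℝ Q ψ) {g : T → StrongDual ℝ E}
    (hg : Measurable g) {u : T → E}
    (hu : ∀ t, IsArgMin (fun v => β * d v + (g t v + ψ v)) Q (u t)) : Measurable u := by
  -- Adding the quadratic growth inequalities of the two minimizers, each tested at the other,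
  -- cancels `d` and `ψ`.
  have hlip : ∀ t t', ‖u t - u t'‖ ≤ β⁻¹ * ‖g t - g t'‖ := by
    intro t t'
    have hconv : ∀ t, ConvexOn ℝ Q fun v => g t v + ψ v := fun t => by
      have := convexOn_clm_comp_sub hψ.1 (g t) 0 1
      simp only [sub_zero, one_mul] at this
      exact this.add hψ
    have h1 := (hu t).add_sq_norm_le hβ.le (hconv t) hd.strongConvex (hd.hasGrad _ (hu t).1)
      (hu t').1
    have h2 := (hu t').add_sq_norm_le hβ.le (hconv t') hd.strongConvex (hd.hasGrad _ (hu t').1)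
      (hu t).1
    rw [norm_sub_rev] at h1
    have h3 : (g t' - g t) (u t - u t') ≤ ‖g t - g t'‖ * ‖u t - u t'‖ := by
      rw [norm_sub_rev (g t)]
      exact (le_abs_self _).trans ((g t' - g t).le_opNorm _)
    simp only [sub_apply, map_sub] at h3
    have h4 : β * ‖u t - u t'‖ ^ 2 ≤ ‖g t - g t'‖ * ‖u t - u t'‖ := by linarith
    rw [le_inv_mul_iff₀ hβ]
    rcases (norm_nonneg (u t - u t')).eq_or_lt with h0 | h0
    · rw [← h0, mul_zero]; exact norm_nonneg _
    · exact le_of_mul_le_mul_right (by linarith) h0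
  -- factor `u` through the range of `g`
  choose pre hpre using fun q : Set.range g => q.2
  have hcont : Continuous fun q : Set.range g => u (pre q) := by
    refine (LipschitzWith.of_dist_le_mul (K := (β⁻¹).toNNReal) fun q q' => ?_).continuous
    rw [dist_eq_norm, Real.coe_toNNReal _ (by positivity)]
    refine (hlip _ _).trans_eq ?_
    rw [hpre, hpre, Subtype.dist_eq, dist_eq_norm]
  have hfac : u = fun t => u (pre ⟨g t, t, rfl⟩) := by
    funext t
    have := hlip t (pre ⟨g t, t, rfl⟩)
    rw [hpre, sub_self, norm_zero, mul_zero] at this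
    exact sub_eq_zero.1 (norm_le_zero_iff.1 this)
  rw [hfac]
  exact hcont.measurable.comp (hg.subtype_mk (h := fun t => ⟨t, rfl⟩))

variable [FiniteDimensional ℝ E]

/-- The gradient of the prox-function agrees, on differences of points of `Q`, with a measurable
map: it may be arbitrary in directions transversal to `Q`. -/
theorem IsProxFunction.exists_measurable_grad (hd : IsProxFunction Q d gradd x₀) :
    ∃ gm : Q → StrongDual ℝ E, Measurable gm ∧
      ∀ z : Q, ∀ u ∈ Q, ∀ v ∈ Q, gm z (u - v) = gradd z (u - v) := by
  have hx₀ := hd.argmin.1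
  set V := Submodule.span ℝ ((fun q => q - x₀) '' Q) with hV
  have hmeas : ∀ v ∈ V, Measurable fun z : Q => gradd z v := by
    intro v hv
    induction hv using Submodule.span_induction with
    | mem v hv =>
      obtain ⟨q, hq, rfl⟩ := hv
      have := (hd.measurable_gradd_sub hq).sub (hd.measurable_gradd_sub hx₀)
      convert this using 1
      funext z
      simp only [Pi.sub_apply]
      rw [← map_sub, sub_sub_sub_cancel_right]
    | zero => simp
    | add u v _ _ hu hv => simp only [map_add]; exact hu.add hv
    | smul a v _ hv => simp only [map_smul]; exact hv.const_smul a
  have hdiff : ∀ u ∈ Q, ∀ v ∈ Q, u - v ∈ V := fun u hu v hv => by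
    have := V.sub_mem (Submodule.subset_span ⟨u, hu, rfl⟩) (Submodule.subset_span ⟨v, hv, rfl⟩)
    simpa using this
  -- Precomposing `gradd z` with a linear projection onto the direction space of `Q` discards the
  -- arbitrary transversal part.
  obtain ⟨π, hπ⟩ := V.subtype.exists_leftInverse_of_injective V.ker_subtype
  have hπv : ∀ v, ∀ hv : v ∈ V, π v = ⟨v, hv⟩ := fun v hv => LinearMap.congr_fun hπ ⟨v, hv⟩
  set b := Module.finBasis ℝ E
  refine ⟨fun z => ∑ j, gradd z (π (b j)) • LinearMap.toContinuousLinearMap (b.coord j), ?_, ?_⟩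
  · exact Finset.measurable_sum _ fun j _ => (hmeas _ (π (b j)).2).smul_const _
  · intro z u hu v hv
    have e : ∑ j, b.repr (u - v) j • (π (b j) : E) = u - v := by
      have h1 : ∑ j, b.repr (u - v) j • (π (b j) : E) = π (∑ j, b.repr (u - v) j • b j) := by
        simp only [map_sum, map_smul, Submodule.coe_sum, Submodule.coe_smul]
      rw [h1, b.sum_repr, hπv _ (hdiff u hu v hv)]
    conv_rhs => rw [← e]
    simp [mul_comm]

end

end Measurability

/-! ### Predictability of the iterates -/

section RunMeasurability

variable {E : Type*} [NormedAddCommGroup E] [NormedSpace ℝ E] [FiniteDimensional ℝ E]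
  [MeasurableSpace E] [BorelSpace E] {Q : Set E} {d h f : E → ℝ} {gradd : E → StrongDual ℝ E}
  {x₀ : E} {Ξ : Type*} [MeasurableSpace Ξ] {G : E → Ξ → StrongDual ℝ E} {S : Type*}
  {ξ : ℕ → S → Ξ} {α β B ρ : ℕ → ℝ} {L : ℝ} {x y z xhat w : ℕ → S → E}

/-- The points `x k`, `anchor k` of the method are functions of the first `k` realizations. -/
theorem measurable_run (hGm : Measurable fun q : Q × Ξ => G q.1 q.2) (hh : ConvexOn ℝ Q h)
    (hd : IsProxFunction Q d gradd x₀) (hc : IsAdmissible α β B ρ L) (hβ : ∀ i, 0 < β i)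
    (hr : ∀ s, IsRun Q d gradd h α β B (fun i v => G v (ξ i s)) (fun i => x i s)
      (fun i => y i s) (fun i => z i s) (fun i => xhat i s) (fun i => w i s)) (k : ℕ) :
    Measurable[history ξ k] (x k) ∧
      Measurable[history ξ k] (fun s => anchor (fun i => x i s) (fun i => z i s) k) := by
  have hQ := hh.1
  have hxQ := fun k s => (hr s).x_mem hQ hc k
  obtain ⟨gm, hgm, hgm_eq⟩ := hd.exists_measurable_grad
  -- the answer at the point `x i`
  have hans : ∀ i, Measurable[history ξ i] (x i) →
      Measurable[history ξ (i + 1)] fun s => G (x i s) (ξ i s) := fun i hi => by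
    have hi' := hi.mono (history_mono i.le_succ) le_rfl
    let _ := history ξ (i + 1)
    exact hGm.comp ((hi'.subtype_mk (h := hxQ i)).prodMk (measurable_history i.lt_succ_self))
  have hA : ∀ k, 0 ≤ partialSum α k := fun k => Finset.sum_nonneg fun i _ => (hc.pos i).le
  -- the points `z k`
  have hz : ∀ k, (∀ i ≤ k, Measurable[history ξ i] (x i)) →
      Measurable[history ξ (k + 1)] (z k) := fun k hx => by
    have hsum : Measurable[history ξ (k + 1)] fun s =>
        ∑ i ∈ Finset.range (k + 1), α i • G (x i s) (ξ i s) := by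
      have hans' : ∀ i ∈ Finset.range (k + 1),
          Measurable[history ξ (k + 1)] fun s => G (x i s) (ξ i s) := fun i hi =>
        (hans i (hx i (Nat.lt_succ_iff.1 (Finset.mem_range.1 hi)))).mono
          (history_mono (Finset.mem_range.1 hi)) le_rfl
      let _ := history ξ (k + 1)
      exact Finset.measurable_sum _ fun i hi => (hans' i hi).const_smul (α i)
    let _ := history ξ (k + 1)
    refine measurable_argmin (hβ k) hd (hh.smul (hA k)) hsum fun s =>
      -- The base points `x i` contribute only terms constant in `v`, so the objective depends on
      -- the randomness through the linear functional alone.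
      ((hr s).z_argmin k).of_eq_add_const
        (-∑ i ∈ Finset.range (k + 1), α i * G (x i s) (ξ i s) (x i s)) fun v _ => ?_
    simp only [map_sub, mul_sub, Finset.sum_sub_distrib, sum_apply,
      smul_apply, smul_eq_mul]
    ring
  -- The offset matters: `x k` precedes the answer to `ξ k`, while `y k` already uses it. All
  -- earlier `x i` are carried along because `z k` involves every past answer.
  have main : ∀ k, (∀ i ≤ k, Measurable[history ξ i] (x i)) ∧
      Measurable[history ξ (k + 1)] (y k) := by
    intro k
    induction k with
    | zero =>
      have hx0 : Measurable[history ξ 0] (x 0) := by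
        have : x 0 = fun _ => x₀ := funext fun s => hd.argmin_unique (hr s).x_zero
        rw [this]
        exact measurable_const
      refine ⟨fun i hi => by obtain rfl := Nat.le_zero.1 hi; exact hx0, ?_⟩
      have hg := hans 0 hx0
      let _ := history ξ (0 + 1)
      refine measurable_argmin (hβ 0) hd (hh.smul (hc.pos 0).le) (hg.const_smul (α 0)) fun s =>
        (hr s).y_zero.of_eq_add_const (-(α 0 * G (x 0 s) (ξ 0 s) (x 0 s))) fun v _ => ?_
      simp only [map_sub, Pi.smul_apply, smul_apply, smul_eq_mul]
      ring
    | succ k ih =>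
      obtain ⟨hx, hy⟩ := ih
      have hzk := hz k hx
      have hxk : Measurable[history ξ (k + 1)] (x (k + 1)) := by
        have : x (k + 1) = fun s => tau α B k • z k s + (1 - tau α B k) • y k s :=
          funext fun s => (hr s).x_succ k
        rw [this]
        exact (hzk.const_smul _).add (hy.const_smul _)
      refine ⟨fun i hi => ?_, ?_⟩
      · rcases Nat.le_succ_iff.1 hi with hi | rfl
        · exact hx i hi
        · exact hxk
      have hle : history ξ (k + 1) ≤ history ξ (k + 1 + 1) := history_mono (k + 1).le_succ
      have hg := hans (k + 1) hxk
      have hzk' := hzk.mono hle le_rfl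
      have hy' := hy.mono hle le_rfl
      have hzQ : ∀ s, z k s ∈ Q := fun s => ((hr s).z_argmin k).1
      let _ := history ξ (k + 1 + 1)
      have hxhat : Measurable (xhat (k + 1)) := by
        refine measurable_argmin (hβ k) hd (hh.smul (hc.pos (k + 1)).le)
          ((hg.const_smul (α (k + 1))).sub
            ((hgm.comp (hzk'.subtype_mk (h := hzQ))).const_smul (β k))) fun s =>
          ((hr s).xhat_succ k).of_eq_add_const (-β k * d (z k s)
            - α (k + 1) * G (x (k + 1) s) (ξ (k + 1) s) (z k s)
            + β k * gm ⟨z k s, hzQ s⟩ (z k s)) fun v hv => ?_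
        have := hgm_eq ⟨z k s, hzQ s⟩ v hv _ (hzQ s)
        simp only [bregman]
        rw [← this]
        simp only [map_sub, Pi.sub_apply, Pi.smul_apply, Function.comp_apply, sub_apply,
          smul_apply, smul_eq_mul]
        ring
      have : y (k + 1) = fun s =>
          ((partialSum α (k + 1) - B (k + 1)) / partialSum α (k + 1)) • y k s
            + (B (k + 1) / partialSum α (k + 1)) •
              (tau α B k • xhat (k + 1) s + (1 - tau α B k) • y k s) := by
        funext s
        rw [← (hr s).w_succ k]
        exact (hr s).y_succ k
      rw [this]
      exact (hy'.const_smul _).add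
        (((hxhat.const_smul _).add (hy'.const_smul _)).const_smul _)
  refine ⟨(main k).1 k le_rfl, ?_⟩
  cases k with
  | zero => exact (main 0).1 0 le_rfl
  | succ k => exact hz k (main k).1

end RunMeasurability

/-! ### Coefficient estimates and the explicit rate -/

section CoefficientBounds

/-- The tangent inequality at `u` for the convex function `t ^ p`, obtained from Bernoulli; it makes
the sum of the growth factors telescope. -/
theorem mul_rpow_le_sub_rpow {p u v : ℝ} (hp : 1 ≤ p) (hu : 0 < u) (hv : 0 ≤ v) :
    u ^ p - v ^ p ≤ p * u ^ (p - 1) * (u - v) := by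
  have h := one_add_mul_self_le_rpow_one_add (s := v / u - 1)
    (by linarith [div_nonneg hv hu.le]) hp
  rw [add_sub_cancel, Real.div_rpow hv hu.le, le_div_iff₀ (Real.rpow_pos_of_pos hu p)] at h
  have h1 : u ^ p = u ^ (p - 1) * u := by
    rw [← Real.rpow_add_one hu.ne', sub_add_cancel]
  have h2 : (1 + p * (v / u - 1)) * u ^ p = u ^ p - p * u ^ (p - 1) * (u - v) := by
    rw [h1]; field_simp; ring
  linarith

/-- A discrete derivative bound for `u ^ q`, `q = p - 1/2`. For `q ≥ 1` Bernoulli applies at `u`;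
for `q ≤ 1` it applies at `u + 1`, and `u + 1 ≤ 2u` loses at most a factor `2`. The constant `4`
covers this loss because `2q ≥ p`. -/
theorem mul_rpow_sub_le {p u : ℝ} (hp1 : 1 ≤ p) (hu : 1 ≤ u) :
    p * u ^ (p - 3 / 2) ≤ 4 * ((u + 1) ^ (p - 1 / 2) - u ^ (p - 1 / 2)) := by
  have hu0 : 0 < u := by linarith
  set q := p - 1 / 2 with hq
  have hq1 : p - 3 / 2 = q - 1 := by rw [hq]; ring
  rw [hq1]
  rcases le_total 1 q with h | h
  · have hB := one_add_mul_self_le_rpow_one_add (s := 1 / u)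
      (by linarith [show 0 ≤ 1 / u by positivity]) h
    rw [show 1 + 1 / u = (u + 1) / u by field_simp, Real.div_rpow (by positivity) hu0.le,
      le_div_iff₀ (Real.rpow_pos_of_pos hu0 q)] at hB
    have h1 : u ^ q = u ^ (q - 1) * u := by rw [← Real.rpow_add_one hu0.ne', sub_add_cancel]
    have h2 : (1 + q * (1 / u)) * u ^ q = u ^ q + q * u ^ (q - 1) := by
      rw [h1]; field_simp
    have h3 : 0 ≤ u ^ (q - 1) := by positivity
    nlinarith
  · have hB := rpow_one_add_le_one_add_mul_self (s := -1 / (u + 1))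
      (by rw [le_div_iff₀ (by positivity)]; linarith) (by linarith : 0 ≤ q) h
    rw [show 1 + -1 / (u + 1) = u / (u + 1) by field_simp; ring, Real.div_rpow hu0.le (by positivity),
      div_le_iff₀ (by positivity)] at hB
    have h1 : (u + 1) ^ q = (u + 1) ^ (q - 1) * (u + 1) := by
      rw [← Real.rpow_add_one (by positivity), sub_add_cancel]
    have h2 : (1 + q * (-1 / (u + 1))) * (u + 1) ^ q = (u + 1) ^ q - q * (u + 1) ^ (q - 1) := by
      rw [h1]; field_simp; ring
    have h3 : (2 : ℝ) ^ (q - 1) * u ^ (q - 1) ≤ (u + 1) ^ (q - 1) := by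
      rw [← Real.mul_rpow (by norm_num) hu0.le]
      exact Real.rpow_le_rpow_of_nonpos (by positivity) (by linarith) (by linarith)
    have h4 : (2 : ℝ)⁻¹ ≤ (2 : ℝ) ^ (q - 1) := by
      rw [← Real.rpow_neg_one]
      exact Real.rpow_le_rpow_of_exponent_le (by norm_num) (by linarith)
    have h5 : 0 ≤ u ^ (q - 1) := by positivity
    have h6 : 2⁻¹ * u ^ (q - 1) ≤ (u + 1) ^ (q - 1) :=
      (mul_le_mul_of_nonneg_right h4 h5).trans h3
    have h7 := mul_le_mul_of_nonneg_left h6 (show 0 ≤ 4 * q by linarith)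
    nlinarith

/-- The growth factor `((i + p) / p) ^ (p - 1)` of the coefficients. -/
noncomputable def growth (p : ℝ) (i : ℕ) : ℝ := (((i : ℝ) + p) / p) ^ (p - 1)

variable {p : ℝ}

theorem one_le_add_div (hp : 1 ≤ p) (i : ℕ) : 1 ≤ ((i : ℝ) + p) / p := by
  rw [one_le_div (by linarith)]
  linarith [i.cast_nonneg (α := ℝ)]

theorem one_le_growth (hp : 1 ≤ p) (i : ℕ) : 1 ≤ growth p i :=
  Real.one_le_rpow (one_le_add_div hp i) (by linarith)

theorem growth_zero (hp : 1 ≤ p) : growth p 0 = 1 := by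
  have : p ≠ 0 := by linarith
  simp [growth, div_self this]

theorem growth_mono (hp : 1 ≤ p) : Monotone (growth p) := fun i j hij => by
  refine Real.rpow_le_rpow (zero_le_one.trans (one_le_add_div hp i)) ?_ (by linarith)
  have : (i : ℝ) ≤ j := Nat.cast_le.2 hij
  gcongr

theorem growth_mul (hp : 1 ≤ p) (i : ℕ) :
    growth p i * (((i : ℝ) + p) / p) = (((i : ℝ) + p) / p) ^ p := by
  rw [growth, ← Real.rpow_add_one (zero_lt_one.trans_le (one_le_add_div hp i)).ne', sub_add_cancel]

/-- The exponents satisfy `2(p - 1) ≤ p` exactly when `p ≤ 2`; this yields `B i ≤ A i`. -/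
theorem growth_sq_le (hp1 : 1 ≤ p) (hp2 : p ≤ 2) (i : ℕ) :
    growth p i ^ 2 ≤ (((i : ℝ) + p) / p) ^ p := by
  have h := one_le_add_div hp1 i
  rw [growth, ← Real.rpow_natCast, ← Real.rpow_mul (zero_le_one.trans h)]
  exact Real.rpow_le_rpow_of_exponent_le h (by push_cast; linarith)

theorem le_sum_growth (hp : 1 ≤ p) (k : ℕ) :
    (((k : ℝ) + p) / p) ^ p ≤ ∑ i ∈ Finset.range (k + 1), growth p i := by
  have hp0 : p ≠ 0 := by linarith
  induction k with
  | zero => simp [growth_zero hp, div_self hp0]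
  | succ k ih =>
    rw [Finset.sum_range_succ]
    have := mul_rpow_le_sub_rpow hp (zero_lt_one.trans_le (one_le_add_div hp (k + 1)))
      (zero_le_one.trans (one_le_add_div hp k))
    have e : p * (((k + 1 : ℕ) + p) / p) ^ (p - 1) * ((((k + 1 : ℕ) : ℝ) + p) / p - ((k : ℝ) + p) / p)
        = growth p (k + 1) := by
      rw [growth]; push_cast; field_simp; ring
    linarith

theorem alphaSeq_eq (p : ℝ) (i : ℕ) : alphaSeq p i = growth p i / aCoef p := by
  rw [alphaSeq, growth]; ring

theorem aCoef_pos (p : ℝ) : 0 < aCoef p := Real.rpow_pos_of_pos two_pos _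

theorem bCoef_pos (hp : 1 ≤ p) : 0 < bCoef p :=
  mul_pos (Real.rpow_pos_of_pos two_pos _) (Real.rpow_pos_of_pos (by linarith) _)

theorem bSeq_eq (p : ℝ) (i : ℕ) : bSeq p i = growth p i ^ 2 / aCoef p := by
  have := (aCoef_pos p).ne'
  rw [bSeq, alphaSeq_eq]; field_simp

theorem one_le_aCoef (hp : 1 ≤ p) : 1 ≤ aCoef p :=
  Real.one_le_rpow (by norm_num) (by linarith)

theorem partialSum_alphaSeq (p : ℝ) (k : ℕ) :
    partialSum (alphaSeq p) k = (∑ i ∈ Finset.range (k + 1), growth p i) / aCoef p := by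
  rw [partialSum, Finset.sum_div]
  exact Finset.sum_congr rfl fun i _ => alphaSeq_eq p i

theorem le_partialSum_alphaSeq (hp : 1 ≤ p) (k : ℕ) :
    (((k : ℝ) + p) / p) ^ p / aCoef p ≤ partialSum (alphaSeq p) k := by
  rw [partialSum_alphaSeq]
  exact div_le_div_of_nonneg_right (le_sum_growth hp k) (aCoef_pos p).le

theorem partialSum_alphaSeq_pos (hp : 1 ≤ p) (k : ℕ) : 0 < partialSum (alphaSeq p) k :=
  (div_pos (Real.rpow_pos_of_pos (zero_lt_one.trans_le (one_le_add_div hp k)) p)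
    (aCoef_pos p)).trans_le (le_partialSum_alphaSeq hp k)

theorem aCoef_mul_bCoef (hp : 1 ≤ p) :
    aCoef p * bCoef p * p ^ p = (2 : ℝ) ^ ((3 + 2 * p) / 4) * √p := by
  have hp0 : 0 < p := by linarith
  rw [aCoef, bCoef, Real.sqrt_eq_rpow, ← mul_assoc, ← Real.rpow_add two_pos, mul_assoc,
    ← Real.rpow_add hp0]
  congr 2 <;> ring

theorem aCoef_mul_bCoef_sq (hp : 1 ≤ p) :
    aCoef p * bCoef p ^ 2 = 4 * p ^ (1 - 2 * p) := by
  have hp0 : 0 < p := by linarith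
  rw [aCoef, bCoef, mul_pow, ← Real.rpow_natCast, ← Real.rpow_natCast, ← Real.rpow_mul two_pos.le,
    ← Real.rpow_mul hp0.le, ← mul_assoc, ← Real.rpow_add two_pos,
    show (2 * p - 1) / 2 + (5 - 2 * p) / 4 * ((2 : ℕ) : ℝ) = (2 : ℕ) by push_cast; ring,
    show (1 - 2 * p) / 2 * ((2 : ℕ) : ℝ) = 1 - 2 * p by push_cast; ring, Real.rpow_natCast]
  norm_num

/-- The part `β_i - L` of `β_i`. -/
noncomputable def rhoSeq (p σ R : ℝ) (i : ℕ) : ℝ :=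
  bCoef p * σ / R * ((i : ℝ) + p + 1) ^ ((2 * p - 1) / 2)

variable {L σ R : ℝ}

theorem rhoSeq_pos (hp : 1 ≤ p) (hσ : 0 < σ) (hR : 0 < R) (i : ℕ) : 0 < rhoSeq p σ R i := by
  have := bCoef_pos hp
  have h : 0 < (i : ℝ) + p + 1 := by positivity
  unfold rhoSeq
  positivity

theorem rhoSeq_mono (hp : 1 ≤ p) (hσ : 0 < σ) (hR : 0 < R) : Monotone (rhoSeq p σ R) :=
  fun i j hij => by
    have := bCoef_pos hp
    have hij' : (i : ℝ) ≤ j := Nat.cast_le.2 hij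
    refine mul_le_mul_of_nonneg_left (Real.rpow_le_rpow (by positivity) (by linarith) (by linarith))
      (by positivity)

/-- The value of `a` comes from `i + p + 2 ≤ 2 (i + p + 1)` raised to the power `(2p - 1) / 2`; it
compensates for the index shift in the balance condition. -/
theorem rhoSeq_succ_le (hp : 1 ≤ p) (hσ : 0 < σ) (hR : 0 < R) (i : ℕ) :
    rhoSeq p σ R (i + 1) ≤ aCoef p * rhoSeq p σ R i := by
  have := bCoef_pos hp
  have hi : (0 : ℝ) ≤ i := i.cast_nonneg
  rw [rhoSeq, rhoSeq, mul_left_comm]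
  refine mul_le_mul_of_nonneg_left ?_ (by positivity)
  rw [aCoef, ← Real.mul_rpow two_pos.le (by linarith)]
  exact Real.rpow_le_rpow (by push_cast; linarith) (by push_cast; linarith) (by linarith)

theorem isAdmissible_coefficients (hp1 : 1 ≤ p) (hp2 : p ≤ 2) (hL : 0 ≤ L) (hσ : 0 < σ)
    (hR : 0 < R) :
    IsAdmissible (alphaSeq p) (betaSeq p L σ R) (bSeq p) (rhoSeq p σ R) L := by
  have ha := aCoef_pos p
  have ha1 := one_le_aCoef hp1
  have hβ : ∀ i, betaSeq p L σ R i = L + rhoSeq p σ R i := fun i => rfl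
  have hρ := rhoSeq_pos hp1 hσ hR
  refine ⟨fun i => ?_, fun i => ?_, ?_, fun i => ?_, fun i => ?_, fun i => ?_, hρ, ?_, fun i => ?_⟩
  · rw [alphaSeq_eq]
    exact div_pos (zero_lt_one.trans_le (one_le_growth hp1 i)) ha
  · rw [alphaSeq_eq, bSeq_eq]
    have := one_le_growth hp1 i
    gcongr
    nlinarith
  · rw [alphaSeq_eq, bSeq_eq, growth_zero hp1, one_pow]
  · rw [bSeq_eq]
    exact (div_le_div_of_nonneg_right (growth_sq_le hp1 hp2 i) ha.le).trans
      (le_partialSum_alphaSeq hp1 i)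
  · rw [hβ]; linarith [hρ i]
  · rw [hβ, hβ]; linarith [rhoSeq_mono hp1 hσ hR i.le_succ]
  · rw [hβ, alphaSeq_eq, growth_zero hp1]
    refine mul_le_of_le_one_left (by linarith [hρ 0]) ?_
    rwa [div_le_one ha]
  · rw [hβ, alphaSeq_eq, bSeq_eq]
    have h1 : L + rhoSeq p σ R (i + 1) ≤ aCoef p * (L + rhoSeq p σ R i) := by
      have := rhoSeq_succ_le hp1 hσ hR i
      nlinarith
    calc (growth p (i + 1) / aCoef p) ^ 2 * (L + rhoSeq p σ R (i + 1))
        ≤ (growth p (i + 1) / aCoef p) ^ 2 * (aCoef p * (L + rhoSeq p σ R i)) :=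
          mul_le_mul_of_nonneg_left h1 (sq_nonneg _)
      _ = (L + rhoSeq p σ R i) * (growth p (i + 1) ^ 2 / aCoef p) := by field_simp

theorem sum_bSeq_le (hp : 1 ≤ p) (k : ℕ) :
    ∑ i ∈ Finset.range (k + 1), bSeq p i ≤ growth p k * partialSum (alphaSeq p) k := by
  rw [partialSum, Finset.mul_sum]
  refine Finset.sum_le_sum fun i hi => ?_
  have h := growth_mono hp (Nat.lt_succ_iff.1 (Finset.mem_range.1 hi))
  have h1 := one_le_growth hp i
  have := aCoef_pos p
  rw [bSeq_eq, alphaSeq_eq, ← mul_div_assoc, sq]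
  gcongr

/-- The factor `p / (k + p)` arises because the largest coefficient is at most that fraction of `A
k`; after a square root it gives the decay of the martingale term. -/
theorem sum_alphaSeq_sq_le (hp : 1 ≤ p) (k : ℕ) :
    ∑ i ∈ Finset.range (k + 1), alphaSeq p i ^ 2
      ≤ partialSum (alphaSeq p) k ^ 2 * (p / ((k : ℝ) + p)) := by
  have ha := aCoef_pos p
  have hA := partialSum_alphaSeq_pos hp k
  have hK : 0 < ((k : ℝ) + p) / p := zero_lt_one.trans_le (one_le_add_div hp k)
  have h1 : ∑ i ∈ Finset.range (k + 1), alphaSeq p i ^ 2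
      ≤ growth p k / aCoef p * partialSum (alphaSeq p) k := by
    have : ∀ i, alphaSeq p i ^ 2 = bSeq p i / aCoef p := fun i => by
      rw [bSeq]; field_simp
    simp only [this]
    rw [← Finset.sum_div, div_mul_eq_mul_div]
    exact div_le_div_of_nonneg_right (sum_bSeq_le hp k) ha.le
  have h2 : growth p k / aCoef p ≤ partialSum (alphaSeq p) k * (p / ((k : ℝ) + p)) := by
    rw [← inv_div ((k : ℝ) + p) p, ← div_eq_mul_inv, le_div_iff₀ hK, div_mul_eq_mul_div,
      growth_mul hp]
    exact le_partialSum_alphaSeq hp k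
  refine h1.trans ((mul_le_mul_of_nonneg_right h2 hA.le).trans_eq (by ring))

theorem sum_rpow_le (hp1 : 1 ≤ p) (k : ℕ) :
    p * ∑ i ∈ Finset.range (k + 1), ((i : ℝ) + p + 1) ^ (p - 3 / 2)
      ≤ 4 * ((k : ℝ) + p + 2) ^ (p - 1 / 2) := by
  have hstep : ∀ i : ℕ, p * ((i : ℝ) + p + 1) ^ (p - 3 / 2)
      ≤ 4 * (((i : ℝ) + p + 2) ^ (p - 1 / 2) - ((i : ℝ) + p + 1) ^ (p - 1 / 2)) := fun i => by
    have := mul_rpow_sub_le hp1 (u := (i : ℝ) + p + 1) (by linarith [i.cast_nonneg (α := ℝ)])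
    rwa [show (i : ℝ) + p + 1 + 1 = i + p + 2 by ring] at this
  induction k with
  | zero =>
    have := hstep 0
    have h0 : 0 ≤ (((0 : ℕ) : ℝ) + p + 1) ^ (p - 1 / 2) := by positivity
    rw [zero_add, Finset.sum_range_one]
    linarith
  | succ k ih =>
    rw [Finset.sum_range_succ, mul_add]
    have := hstep (k + 1)
    rw [show ((k + 1 : ℕ) : ℝ) + p + 1 = k + p + 2 by push_cast; ring] at this ⊢
    linarith

/-- The identity `a b² = 4 p ^ (1 - 2p)` brings this noise sum, times `σ`, under the same bound
`σRbM / 2`, with `M = (k + p + 2) ^ (p - 1/2)`, that controls the prox term. -/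
theorem sum_bSeq_div_le (hp1 : 1 ≤ p) (hσ : 0 < σ) (hR : 0 < R) (k : ℕ) :
    σ * ∑ i ∈ Finset.range (k + 1), bSeq p i / (2 * rhoSeq p σ R i)
      ≤ R * bCoef p * ((k : ℝ) + p + 2) ^ (p - 1 / 2) / 2 := by
  have ha := aCoef_pos p
  have hb := bCoef_pos hp1
  have hp0 : 0 < p := by linarith
  have hterm : ∀ i : ℕ, σ * (bSeq p i / (2 * rhoSeq p σ R i))
      ≤ R * bCoef p / 8 * (p * ((i : ℝ) + p + 1) ^ (p - 3 / 2)) := fun i => by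
    have hi : (0 : ℝ) ≤ i := i.cast_nonneg
    set u := (i : ℝ) + p + 1 with hu
    have hu0 : 0 < u := by positivity
    have hg : growth p i ^ 2 ≤ u ^ (2 * p - 2) * p ^ (1 - 2 * p) * p := by
      have h1 : growth p i ≤ (u / p) ^ (p - 1) := by
        refine Real.rpow_le_rpow (by positivity) ?_ (by linarith)
        gcongr
        linarith
      have h2 : ((u / p) ^ (p - 1)) ^ 2 = u ^ (2 * p - 2) * p ^ (1 - 2 * p) * p := by
        rw [← Real.rpow_natCast, ← Real.rpow_mul (by positivity), Real.div_rpow hu0.le hp0.le,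
          mul_assoc, ← Real.rpow_add_one hp0.ne', div_eq_mul_inv, ← Real.rpow_neg hp0.le]
        congr 2 <;> push_cast <;> ring
      rw [← h2]
      exact pow_le_pow_left₀ (zero_le_one.trans (one_le_growth hp1 i)) h1 2
    have hpow : u ^ (2 * p - 2) = u ^ (p - 3 / 2) * u ^ ((2 * p - 1) / 2) := by
      rw [← Real.rpow_add hu0]; congr 1; ring
    have hE : 0 < u ^ ((2 * p - 1) / 2) := by positivity
    have hbb : p ^ (1 - 2 * p) = aCoef p * bCoef p ^ 2 / 4 := by
      rw [aCoef_mul_bCoef_sq hp1]; ring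
    calc σ * (bSeq p i / (2 * rhoSeq p σ R i))
        = R / (2 * aCoef p * bCoef p * u ^ ((2 * p - 1) / 2)) * growth p i ^ 2 := by
          rw [bSeq_eq, rhoSeq, ← hu]; field_simp
      _ ≤ R / (2 * aCoef p * bCoef p * u ^ ((2 * p - 1) / 2)) *
            (u ^ (2 * p - 2) * p ^ (1 - 2 * p) * p) :=
          mul_le_mul_of_nonneg_left hg (by positivity)
      _ = R * bCoef p / 8 * (p * u ^ (p - 3 / 2)) := by
          rw [hpow, hbb]; field_simp; ring
  rw [Finset.mul_sum]
  refine (Finset.sum_le_sum fun i _ => hterm i).trans ?_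
  rw [← Finset.mul_sum, ← Finset.mul_sum]
  refine (mul_le_mul_of_nonneg_left (sum_rpow_le hp1 k) (by positivity)).trans_eq ?_
  ring

/-- The explicit rate dominates the three deterministic error terms and the deviation terms. -/
theorem error_terms_le {δ Ω D : ℝ} (hp1 : 1 ≤ p) (hL : 0 ≤ L) (hσ : 0 < σ)
    (hR : 0 < R) (hD : 0 < D) (hδ : 0 ≤ δ) (hΩ : 0 ≤ Ω) (k : ℕ) :
    betaSeq p L σ R k * (R ^ 2 / 2) + (∑ i ∈ Finset.range (k + 1), bSeq p i) * δ
      + (1 + Ω) * σ ^ 2 * ∑ i ∈ Finset.range (k + 1), bSeq p i / (2 * rhoSeq p σ R i)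
      + 2 * σ * √(Ω * ∑ i ∈ Finset.range (k + 1), (alphaSeq p i * D) ^ 2)
    ≤ partialSum (alphaSeq p) k *
      (L * R ^ 2 * p ^ p * (2 : ℝ) ^ ((2 * p - 3) / 2) / ((k : ℝ) + p) ^ p
        + (1 + Ω) * σ * R * (2 : ℝ) ^ ((3 + 2 * p) / 4) * √p
            * ((k : ℝ) + p + 2) ^ (p - 1 / 2) / ((k : ℝ) + p) ^ p
        + (2 : ℝ) ^ (2 * p - 1) * ((((k : ℝ) + p) / p) ^ (p - 1) + 1) * δ
        + 2 * D * σ * √(6 * Ω * p) / √((k : ℝ) + p)) := by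
  have ha := aCoef_pos p
  have hb := bCoef_pos hp1
  have hp0 : 0 < p := by linarith
  have hk : (0 : ℝ) ≤ k := k.cast_nonneg
  have hK : 0 < (k : ℝ) + p := by linarith
  have hA := partialSum_alphaSeq_pos hp1 k
  set A := partialSum (alphaSeq p) k with hAdef
  set Kp := ((k : ℝ) + p) ^ p with hKp
  have hKp0 : 0 < Kp := Real.rpow_pos_of_pos hK p
  have hpp : 0 < p ^ p := Real.rpow_pos_of_pos hp0 p
  -- The lower bound on `A` in a normalized form, used to insert the factor `A` into each error that
  -- decays like `1 / Kp`.
  have hAK : 1 ≤ A * (aCoef p * p ^ p / Kp) := by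
    have := le_partialSum_alphaSeq hp1 k
    rw [Real.div_rpow hK.le hp0.le, div_div, div_le_iff₀ (by positivity)] at this
    rw [← mul_div_assoc, le_div_iff₀ hKp0, mul_comm (aCoef p)]
    linarith
  have hscale : ∀ X : ℝ, 0 ≤ X → X ≤ A * (X * (aCoef p * p ^ p / Kp)) := fun X hX => by
    have := mul_le_mul_of_nonneg_left hAK hX
    linarith
  set M := ((k : ℝ) + p + 2) ^ (p - 1 / 2) with hM
  have hM0 : 0 ≤ M := by positivity
  have h1 : L * (R ^ 2 / 2) ≤ A * (L * R ^ 2 * p ^ p * (2 : ℝ) ^ ((2 * p - 3) / 2) / Kp) := by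
    have e : (2 : ℝ) ^ ((2 * p - 3) / 2) = aCoef p / 2 := by
      rw [aCoef, show (2 * p - 3) / 2 = (2 * p - 1) / 2 - 1 by ring, Real.rpow_sub_one two_ne_zero]
    rw [e]
    refine (hscale _ (by positivity)).trans_eq ?_
    ring
  have h2 : rhoSeq p σ R k * (R ^ 2 / 2)
      + (1 + Ω) * σ ^ 2 * ∑ i ∈ Finset.range (k + 1), bSeq p i / (2 * rhoSeq p σ R i)
      ≤ A * ((1 + Ω) * σ * R * (2 : ℝ) ^ ((3 + 2 * p) / 4) * √p * M / Kp) := by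
    have h21 : rhoSeq p σ R k * (R ^ 2 / 2) ≤ σ * (R * bCoef p * M / 2) := by
      have : ((k : ℝ) + p + 1) ^ ((2 * p - 1) / 2) ≤ M := by
        rw [hM, show (2 * p - 1) / 2 = p - 1 / 2 by ring]
        exact Real.rpow_le_rpow (by positivity) (by linarith) (by linarith)
      calc rhoSeq p σ R k * (R ^ 2 / 2)
          = σ * (R * bCoef p * ((k : ℝ) + p + 1) ^ ((2 * p - 1) / 2) / 2) := by
            rw [rhoSeq]; field_simp
        _ ≤ σ * (R * bCoef p * M / 2) := by gcongr
    have h22 := mul_le_mul_of_nonneg_left (sum_bSeq_div_le hp1 hσ hR k)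
      (show 0 ≤ (1 + Ω) * σ by positivity)
    have h23 : 0 ≤ σ * (R * bCoef p * M / 2) := by positivity
    have h24 := hscale ((1 + Ω) * σ * R * bCoef p * M) (by positivity)
    have h25 : A * ((1 + Ω) * σ * R * bCoef p * M * (aCoef p * p ^ p / Kp))
        = A * ((1 + Ω) * σ * R * (2 : ℝ) ^ ((3 + 2 * p) / 4) * √p * M / Kp) := by
      rw [mul_assoc ((1 + Ω) * σ * R) _ √p, ← aCoef_mul_bCoef hp1]; ring
    rw [← h25]
    refine le_trans ?_ h24
    have h26 := mul_nonneg hΩ h23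
    rw [← hM] at h22
    linarith
  have h3 : (∑ i ∈ Finset.range (k + 1), bSeq p i) * δ
      ≤ A * ((2 : ℝ) ^ (2 * p - 1) * ((((k : ℝ) + p) / p) ^ (p - 1) + 1) * δ) := by
    have h31 : (1 : ℝ) ≤ 2 ^ (2 * p - 1) := Real.one_le_rpow (by norm_num) (by linarith)
    have h32 := one_le_growth hp1 k
    have h33 : growth p k ≤ 2 ^ (2 * p - 1) * (growth p k + 1) := by nlinarith
    calc (∑ i ∈ Finset.range (k + 1), bSeq p i) * δ ≤ growth p k * A * δ :=
          mul_le_mul_of_nonneg_right (sum_bSeq_le hp1 k) hδ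
      _ ≤ (2 ^ (2 * p - 1) * (growth p k + 1)) * A * δ := by gcongr
      _ = _ := by rw [growth]; ring
  have h4 : 2 * σ * √(Ω * ∑ i ∈ Finset.range (k + 1), (alphaSeq p i * D) ^ 2)
      ≤ A * (2 * D * σ * √(6 * Ω * p) / √((k : ℝ) + p)) := by
    have h41 : √(Ω * ∑ i ∈ Finset.range (k + 1), (alphaSeq p i * D) ^ 2)
        ≤ A * D * (√(6 * Ω * p) / √((k : ℝ) + p)) := by
      rw [← Real.sqrt_div' _ hK.le]
      refine Real.sqrt_le_iff.2 ⟨by positivity, ?_⟩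
      rw [mul_pow _ √_, Real.sq_sqrt (by positivity)]
      simp only [mul_pow]
      rw [← Finset.sum_mul]
      calc Ω * ((∑ i ∈ Finset.range (k + 1), alphaSeq p i ^ 2) * D ^ 2)
          ≤ Ω * (A ^ 2 * (p / ((k : ℝ) + p)) * D ^ 2) := by
            gcongr
            exact sum_alphaSeq_sq_le hp1 k
        -- The factor `6` is slack in the stated rate.
        _ ≤ 6 * (Ω * (A ^ 2 * (p / ((k : ℝ) + p)) * D ^ 2)) :=
            le_mul_of_one_le_left (by positivity) (by norm_num)
        _ = A ^ 2 * D ^ 2 * (6 * Ω * p / ((k : ℝ) + p)) := by ring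
    refine (mul_le_mul_of_nonneg_left h41 (by positivity)).trans_eq ?_
    ring
  have hβ : betaSeq p L σ R k = L + rhoSeq p σ R k := rfl
  rw [hβ]
  simp only [mul_add A]
  linarith

/-- The explicit rate is dominated by the simplified one. -/
theorem rate_le {δ Ω D : ℝ} (hp1 : 1 ≤ p) (hp2 : p ≤ 2) (hL : 0 ≤ L) (hσ : 0 < σ)
    (hR : 0 < R) (hD : 0 < D) (hδ : 0 ≤ δ) (hΩ : 0 ≤ Ω) {k : ℕ} (hk : 1 ≤ k) :
    L * R ^ 2 * p ^ p * (2 : ℝ) ^ ((2 * p - 3) / 2) / ((k : ℝ) + p) ^ p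
        + (1 + Ω) * σ * R * (2 : ℝ) ^ ((3 + 2 * p) / 4) * √p
            * ((k : ℝ) + p + 2) ^ (p - 1 / 2) / ((k : ℝ) + p) ^ p
        + (2 : ℝ) ^ (2 * p - 1) * ((((k : ℝ) + p) / p) ^ (p - 1) + 1) * δ
        + 2 * D * σ * √(6 * Ω * p) / √((k : ℝ) + p)
    ≤ 4 * √2 * L * R ^ 2 / (k : ℝ) ^ p
        + 16 * √2 * (1 + Ω) * σ * R / √(k : ℝ)
        + 48 * (k : ℝ) ^ (p - 1) * δ
        + 4 * √3 * D * σ * √Ω / √(k : ℝ) := by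
  have hp0 : 0 < p := by linarith
  have hk1 : (1 : ℝ) ≤ k := by exact_mod_cast hk
  have hk0 : (0 : ℝ) < k := by linarith
  have hK : 0 < (k : ℝ) + p := by linarith
  have two_rpow_le : ∀ {x y : ℝ}, x ≤ y → (2 : ℝ) ^ x ≤ 2 ^ y := fun h =>
    Real.rpow_le_rpow_of_exponent_le (by norm_num) h
  have hkp : (k : ℝ) ^ p ≤ ((k : ℝ) + p) ^ p := Real.rpow_le_rpow hk0.le (by linarith) hp0.le
  have hkp0 : 0 < (k : ℝ) ^ p := Real.rpow_pos_of_pos hk0 p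
  have hsk : √(k : ℝ) ≤ √((k : ℝ) + p) := Real.sqrt_le_sqrt (by linarith)
  have hsk0 : 0 < √(k : ℝ) := Real.sqrt_pos.2 hk0
  have h1 : L * R ^ 2 * p ^ p * (2 : ℝ) ^ ((2 * p - 3) / 2) / ((k : ℝ) + p) ^ p
      ≤ 4 * √2 * L * R ^ 2 / (k : ℝ) ^ p := by
    have e1 : p ^ p ≤ 4 := by
      calc p ^ p ≤ 2 ^ p := Real.rpow_le_rpow hp0.le hp2 hp0.le
        _ ≤ (2 : ℝ) ^ (2 : ℝ) := two_rpow_le hp2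
        _ = 4 := by norm_num
    have e2 : (2 : ℝ) ^ ((2 * p - 3) / 2) ≤ √2 := by
      rw [Real.sqrt_eq_rpow]
      exact two_rpow_le (by linarith)
    calc L * R ^ 2 * p ^ p * (2 : ℝ) ^ ((2 * p - 3) / 2) / ((k : ℝ) + p) ^ p
        ≤ L * R ^ 2 * 4 * √2 / (k : ℝ) ^ p := by gcongr
      _ = _ := by ring
  have h2 : (1 + Ω) * σ * R * (2 : ℝ) ^ ((3 + 2 * p) / 4) * √p
      * ((k : ℝ) + p + 2) ^ (p - 1 / 2) / ((k : ℝ) + p) ^ p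
      ≤ 16 * √2 * (1 + Ω) * σ * R / √(k : ℝ) := by
    have e1 : ((k : ℝ) + p + 2) ^ (p - 1 / 2) ≤ 2 ^ (p - 1 / 2) * ((k : ℝ) + p) ^ (p - 1 / 2) := by
      rw [← Real.mul_rpow two_pos.le hK.le]
      exact Real.rpow_le_rpow (by positivity) (by linarith) (by linarith)
    have e2 : ((k : ℝ) + p) ^ p = ((k : ℝ) + p) ^ (p - 1 / 2) * √((k : ℝ) + p) := by
      rw [Real.sqrt_eq_rpow, ← Real.rpow_add hK]; congr 1; ring
    have e3 : (2 : ℝ) ^ ((3 + 2 * p) / 4) * 2 ^ (p - 1 / 2) ≤ 16 := by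
      rw [← Real.rpow_add two_pos]
      calc (2 : ℝ) ^ ((3 + 2 * p) / 4 + (p - 1 / 2)) ≤ 2 ^ (4 : ℝ) := two_rpow_le (by linarith)
        _ = 16 := by norm_num
    have e4 : √p ≤ √2 := Real.sqrt_le_sqrt hp2
    have hq : 0 < ((k : ℝ) + p) ^ (p - 1 / 2) := Real.rpow_pos_of_pos hK _
    calc (1 + Ω) * σ * R * (2 : ℝ) ^ ((3 + 2 * p) / 4) * √p
          * ((k : ℝ) + p + 2) ^ (p - 1 / 2) / ((k : ℝ) + p) ^ p
        ≤ (1 + Ω) * σ * R * (2 : ℝ) ^ ((3 + 2 * p) / 4) * √p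
          * (2 ^ (p - 1 / 2) * ((k : ℝ) + p) ^ (p - 1 / 2)) / ((k : ℝ) + p) ^ p := by gcongr
      _ = (1 + Ω) * σ * R * ((2 : ℝ) ^ ((3 + 2 * p) / 4) * 2 ^ (p - 1 / 2)) * √p
          / √((k : ℝ) + p) := by rw [e2]; field_simp
      _ ≤ (1 + Ω) * σ * R * 16 * √2 / √(k : ℝ) := by gcongr
      _ = _ := by ring
  have h3 : (2 : ℝ) ^ (2 * p - 1) * ((((k : ℝ) + p) / p) ^ (p - 1) + 1) * δ
      ≤ 48 * (k : ℝ) ^ (p - 1) * δ := by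
    have e1 : (2 : ℝ) ^ (2 * p - 1) ≤ 8 := by
      calc (2 : ℝ) ^ (2 * p - 1) ≤ 2 ^ (3 : ℝ) := two_rpow_le (by linarith)
        _ = 8 := by norm_num
    have e2 : (((k : ℝ) + p) / p) ^ (p - 1) ≤ 2 * (k : ℝ) ^ (p - 1) := by
      have hle : ((k : ℝ) + p) / p ≤ 2 * k := by
        rw [div_le_iff₀ hp0]
        nlinarith
      calc (((k : ℝ) + p) / p) ^ (p - 1) ≤ (2 * k) ^ (p - 1) :=
            Real.rpow_le_rpow (by positivity) hle (by linarith)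
        _ = 2 ^ (p - 1) * (k : ℝ) ^ (p - 1) := Real.mul_rpow two_pos.le hk0.le
        _ ≤ 2 ^ (1 : ℝ) * (k : ℝ) ^ (p - 1) :=
            mul_le_mul_of_nonneg_right (two_rpow_le (by linarith)) (by positivity)
        _ = _ := by rw [Real.rpow_one]
    have e3 : 1 ≤ (k : ℝ) ^ (p - 1) := Real.one_le_rpow hk1 (by linarith)
    refine mul_le_mul_of_nonneg_right ?_ hδ
    calc (2 : ℝ) ^ (2 * p - 1) * ((((k : ℝ) + p) / p) ^ (p - 1) + 1)
        ≤ 8 * (2 * (k : ℝ) ^ (p - 1) + 1) := by gcongr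
      _ ≤ 48 * (k : ℝ) ^ (p - 1) := by linarith
  have h4 : 2 * D * σ * √(6 * Ω * p) / √((k : ℝ) + p) ≤ 4 * √3 * D * σ * √Ω / √(k : ℝ) := by
    have e1 : √(6 * Ω * p) ≤ 2 * √3 * √Ω := by
      refine Real.sqrt_le_iff.2 ⟨by positivity, ?_⟩
      rw [mul_pow, mul_pow, Real.sq_sqrt (by norm_num), Real.sq_sqrt hΩ]
      nlinarith
    calc 2 * D * σ * √(6 * Ω * p) / √((k : ℝ) + p)
        ≤ 2 * D * σ * (2 * √3 * √Ω) / √(k : ℝ) := by gcongr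
      _ = _ := by ring
  linarith

end CoefficientBounds

end SIGM

/-! ### Assembly of the large-deviation bound -/

theorem mainTheorem2
    {E : Type*} [NormedAddCommGroup E] [NormedSpace ℝ E] [FiniteDimensional ℝ E]
    [MeasurableSpace E] [BorelSpace E]
    -- the composite problem: minimize `f + h` on `Q`, with a solution `xstar`
    (Q : Set E) (hQclosed : IsClosed Q) (hQconvex : Convex ℝ Q)
    (f h : E → ℝ) (hf : ConvexOn ℝ Q f) (hh : ConvexOn ℝ Q h)
    (xstar : E) (hxstar : SIGM.IsArgMin (fun v => f v + h v) Q xstar)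
    -- the prox-function
    (d : E → ℝ) (gradd : E → StrongDual ℝ E) (x₀ : E)
    (hd : SIGM.IsProxFunction Q d gradd x₀)
    -- the parameters
    (p L δ σ R D : ℝ) (hp : p ∈ Set.Icc (1 : ℝ) 2) (hL : 0 ≤ L) (hσ : 0 < σ)
    (hR : 0 < R) (hRd : √(2 * d xstar) ≤ R)
    (hD : 0 < D) (hQD : ∀ u ∈ Q, ∀ v ∈ Q, ‖u - v‖ ≤ D)
    -- the stochastic inexact oracle, with light tails
    {Ξ : Type*} [MeasurableSpace Ξ] (ν : Measure Ξ)
    (fo : E → ℝ) (go : E → StrongDual ℝ E) (F : E → Ξ → ℝ) (G : E → Ξ → StrongDual ℝ E)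
    (horacle : SIGM.IsStochasticOracle ν Q f L δ σ fo go F G)
    (hlight : SIGM.IsLightTailed ν Q σ go G)
    -- the i.i.d. realizations, with common law `ν`
    {S : Type*} [MeasurableSpace S] (P : Measure S) [IsProbabilityMeasure P]
    (ξ : ℕ → S → Ξ) (hξmeas : ∀ i, Measurable (ξ i))
    (hξlaw : ∀ i, P.map (ξ i) = ν) (hξindep : iIndepFun ξ P)
    -- the random sequences generated by the method
    (x y z xhat w : ℕ → S → E)
    (hrun : ∀ s : S, SIGM.IsRun Q d gradd h (SIGM.alphaSeq p) (SIGM.betaSeq p L σ R)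
      (SIGM.bSeq p) (fun i v => G v (ξ i s))
      (fun i => x i s) (fun i => y i s) (fun i => z i s) (fun i => xhat i s) (fun i => w i s))
    (k : ℕ) (hk : 1 ≤ k) (Ω : ℝ) (hΩ : 0 ≤ Ω) :
    P {s | (f (y k s) + h (y k s)) - (f xstar + h xstar) >
          4 * √2 * L * R ^ 2 / (k : ℝ) ^ p
            + 16 * √2 * (1 + Ω) * σ * R / √(k : ℝ)
            + 48 * (k : ℝ) ^ (p - 1) * δ
            + 4 * √3 * D * σ * √Ω / √(k : ℝ)}
      ≤ P {s | (f (y k s) + h (y k s)) - (f xstar + h xstar) >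
          L * R ^ 2 * p ^ p * (2 : ℝ) ^ ((2 * p - 3) / 2) / ((k : ℝ) + p) ^ p
            + (1 + Ω) * σ * R * (2 : ℝ) ^ ((3 + 2 * p) / 4) * √p
                * ((k : ℝ) + p + 2) ^ (p - 1 / 2) / ((k : ℝ) + p) ^ p
            + (2 : ℝ) ^ (2 * p - 1) * ((((k : ℝ) + p) / p) ^ (p - 1) + 1) * δ
            + 2 * D * σ * √(6 * Ω * p) / √((k : ℝ) + p)}
    ∧ P {s | (f (y k s) + h (y k s)) - (f xstar + h xstar) >
          L * R ^ 2 * p ^ p * (2 : ℝ) ^ ((2 * p - 3) / 2) / ((k : ℝ) + p) ^ p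
            + (1 + Ω) * σ * R * (2 : ℝ) ^ ((3 + 2 * p) / 4) * √p
                * ((k : ℝ) + p + 2) ^ (p - 1 / 2) / ((k : ℝ) + p) ^ p
            + (2 : ℝ) ^ (2 * p - 1) * ((((k : ℝ) + p) / p) ^ (p - 1) + 1) * δ
            + 2 * D * σ * √(6 * Ω * p) / √((k : ℝ) + p)}
      ≤ ENNReal.ofReal (3 * Real.exp (-Ω)) := by
  obtain ⟨hp1, hp2⟩ := hp
  have hxQ := hxstar.1
  have hδ : 0 ≤ δ := by
    have := horacle.inexact xstar hxQ xstar hxQ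
    simp only [sub_self, map_zero, norm_zero] at this
    linarith [this.1, this.2]
  have hrate := SIGM.rate_le (D := D) hp1 hp2 hL hσ hR hD hδ hΩ hk
  have herr := SIGM.error_terms_le (δ := δ) (Ω := Ω) (D := D) hp1 hL hσ hR hD hδ hΩ k
  refine ⟨measure_mono fun s hs => lt_of_le_of_lt hrate hs, ?_⟩
  have hc := SIGM.isAdmissible_coefficients (p := p) (σ := σ) (R := R) hp1 hp2 hL hσ hR
  have hρ := SIGM.rhoSeq_pos hp1 hσ hR
  have hβ : ∀ i, 0 < SIGM.betaSeq p L σ R i := fun i => add_pos_of_nonneg_of_pos hL (hρ i)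
  have hmeas := SIGM.measurable_run horacle.measurable_G hh hd hc hβ hrun
  have hX := fun i => (hmeas i).1
  have hXQ := fun i s => (hrun s).x_mem hf.1 hc i
  have hB : ∀ i, 0 < SIGM.bSeq p i := fun i => (hc.pos i).trans_le (hc.le_B i)
  set U : ℕ → S → E := fun i s =>
    SIGM.alphaSeq p i • (xstar - SIGM.anchor (fun i => x i s) (fun i => z i s) i) with hU
  have hUm : ∀ i, Measurable[SIGM.history ξ i] (U i) := fun i =>
    ((hmeas i).2.const_sub xstar).const_smul _
  have hUr : ∀ i s, ‖U i s‖ ≤ SIGM.alphaSeq p i * D := fun i s => by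
    rw [hU, norm_smul, Real.norm_of_nonneg (hc.pos i).le]
    exact mul_le_mul_of_nonneg_left (hQD _ hxQ _ ((hrun s).anchor_mem i)) (hc.pos i).le
  have hdev1 := SIGM.measure_sum_sq_noise_lt_le horacle hlight hσ hξmeas hξlaw hξindep hX hXQ
    (c := fun i => SIGM.bSeq p i / (2 * SIGM.rhoSeq p σ R i))
    (fun i => div_nonneg (hB i).le (mul_pos two_pos (hρ i)).le) (k + 1)
    (Finset.sum_pos (fun i _ => div_pos (hB i) (mul_pos two_pos (hρ i))) (by simp)) Ω
  have hdev2 := SIGM.measure_sum_noise_lt_le horacle hlight hσ hξmeas hξlaw hξindep hX hXQ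
    hUm hUr (k + 1) hΩ
    (Finset.sum_pos (fun i _ => pow_pos (mul_pos (hc.pos i) hD) 2) (by simp))
  -- Only two bad events occur, so one of the three allowed exponentials is spare.
  have htwo : ENNReal.ofReal (Real.exp (-Ω)) + ENNReal.ofReal (Real.exp (-Ω))
      ≤ ENNReal.ofReal (3 * Real.exp (-Ω)) := by
    rw [← ENNReal.ofReal_add (Real.exp_pos _).le (Real.exp_pos _).le]
    exact ENNReal.ofReal_le_ofReal (by linarith [Real.exp_pos (-Ω)])
  refine le_trans (measure_mono fun s hs => ?_)
    ((measure_union_le _ _).trans ((add_le_add hdev1 hdev2).trans htwo))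
  -- Outside both bad events, the pathwise bound and the coefficient estimates contradict the
  -- assumed excess of the gap.
  by_contra hcon
  obtain ⟨h1, h2⟩ := not_or.1 hcon
  rw [Set.mem_ofPred_eq, not_lt] at h1 h2
  have hgap := (hrun s).gap_le hf hh hd horacle.inexact hc hxQ k
  have hdx : SIGM.betaSeq p L σ R k * d xstar ≤ SIGM.betaSeq p L σ R k * (R ^ 2 / 2) := by
    refine mul_le_mul_of_nonneg_left ?_ (hβ k).le
    have := (Real.sqrt_le_left hR.le).1 hRd
    linarith
  have hlt := mul_lt_mul_of_pos_left hs (SIGM.partialSum_alphaSeq_pos hp1 k)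
  linarith
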